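/- Let $\mathfrak X^*$ be the free monoid over a countably infinite alphabet $\mathfrak X$ that contains the pairwise distinct letters $x,y,z,t$ and $x,y_i,z_i,t_i$ ($i\in\mathbb N=\{1,2,\dots\}$). For a set $\Sigma$ of identities let $\operatorname{var}\Sigma$ be the variety of all monoids that satisfy $\Sigma$; for a monoid variety $\mathbf V$ let $\mathrm{FIC}(\mathbf V)=\{(\mathbf u,\mathbf v)\in\mathfrak X^*\times\mathfrak X^*\mid \mathbf V\text{ satisfies }\mathbf u\approx\mathbf v\}$ be the corresponding fully invariant congruence, and let $\mathfrak L(\mathbf V)$ be the lattice of all subvarieties of $\mathbf V$. For a congruence $\alpha$ on $\mathfrak X^*$ and a word $\mathbf u$, let $[\mathbf u]^\alpha$ be the $\alpha$-class of $\mathbf u$. For a set $\mathtt W$ of $\alpha$-classes, let $M_\alpha(\mathtt W)$ be the Rees quotient of $\mathfrak X^*/\alpha$ over the ideal of all $\alpha$-classes $\mathtt v$ such that no element of $\mathtt W$ has the form $\mathtt p\mathtt v\mathtt s$ with $\mathtt p,\mathtt s\in\mathfrak X^*/\alpha$, and let $\mathbf M_\alpha(\mathtt W)$ be the monoid variety generated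 by $M_\alpha(\mathtt W)$. Put $$\Sigma_1:=\{xyx^2\approx x^2yx,\ x^2y^2\approx y^2x^2,\ xzxyty\approx xzyxty\},$$ $$\alpha_1:=\mathrm{FIC}(\operatorname{var}\Sigma_1),\qquad \alpha_1^{\circ}:=\mathrm{FIC}(\operatorname{var}(\Sigma_1\cup\{x^2\approx x^3\})).$$ For $k\in\mathbb N$ let $S_{2k}^\sharp$ be the set of all permutations $\pi$ of $\{1,\dots,2k\}$ (written $i\mapsto i\pi$) with $k+1\le 1\pi,\dots,k\pi\le 2k$ and $1\le (k+1)\pi,\dots,(2k)\pi\le k$, and for $\pi\in S_{2k}^\sharp$ put $$\mathbf a_{k,k}[\pi]:=\Bigl(\prod_{i=1}^k z_it_i\Bigr)\,x\,\Bigl(\prod_{i=1}^{2k-1} z_{i\pi}y_i^2\Bigr)z_{(2k)\pi}\,x\,\Bigl(\prod_{i=k+1}^{2k} t_iz_i\Bigr).$$ **Proposition.** For every $k\in\mathbb N$, every $\pi\in S_{2k}^\sharp$ and each $\alpha\in\{\alpha_1,\alpha_1^\circ\}$, the lattice $\mathfrak L\bigl(\mathbf M_{\alpha}(\{[\mathbf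 a_{k,k}[\pi]]^{\alpha}\})\bigr)$ is not distributive. -/

import Mathlib

/-- The alphabet: a countably infinite set of letters `x`, `y i`, `z i`, `t i`. -/
inductive Letter : Type
  | x : Letter
  | y : ℕ → Letter
  | z : ℕ → Letter
  | t : ℕ → Letter
  deriving DecidableEq

instance Letter.instCountable : Countable Letter := by
  refine Function.Injective.countable (β := ℕ × ℕ) (f := fun l => match l with
    | Letter.x => (0, 0)
    | Letter.y i => (1, i)
    | Letter.z i => (2, i)
    | Letter.t i => (3, i)) ?_
  intro a b h
  cases a <;> cases b <;> simp_all

instance Letter.instInfinite : Infinite Letter :=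
  Infinite.of_injective Letter.y (fun _ _ h => Letter.y.inj h)

/-- Words are elements of the free monoid over the alphabet. -/
abbrev Word : Type := FreeMonoid Letter

/-- An identity `u ≈ v` is a pair of words. -/
abbrev MonoidIdentity : Type := Word × Word

/-- The monoid `M` satisfies the identity `u ≈ v`: `φ(u) = φ(v)` for every substitution `φ`. -/
def MonoidSatisfies (M : Type) [Monoid M] (e : MonoidIdentity) : Prop :=
  ∀ φ : Letter → M, FreeMonoid.lift φ e.1 = FreeMonoid.lift φ e.2

/-- The class of all monoids satisfying every identity in `S`. -/
def equationalClass (S : Set MonoidIdentity) : Set MonCat.{0} :=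
  {M | ∀ e ∈ S, MonoidSatisfies M e}

/-- A monoid variety is a class of monoids given by a set of identities. -/
@[ext]
structure MonoidVariety : Type 1 where
  carrier : Set MonCat.{0}
  equational : ∃ S : Set MonoidIdentity, carrier = equationalClass S

namespace MonoidVariety

/-- `var S`, the variety given by the set `S` of identities. -/
def ofIdentities (S : Set MonoidIdentity) : MonoidVariety := ⟨equationalClass S, S, rfl⟩

/-- The variety `V` satisfies the identity `e`. -/
def Satisfies (V : MonoidVariety) (e : MonoidIdentity) : Prop :=
  ∀ M ∈ V.carrier, MonoidSatisfies M e

/-- Varieties are ordered by inclusion. -/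
instance instPartialOrder : PartialOrder MonoidVariety :=
  PartialOrder.lift carrier (fun _ _ h => MonoidVariety.ext h)

theorem mem_of_satisfies (V : MonoidVariety) (M : MonCat.{0})
    (h : ∀ e, V.Satisfies e → MonoidSatisfies M e) : M ∈ V.carrier := by
  obtain ⟨S, hS⟩ := V.equational
  rw [hS]
  intro e he
  refine h e (fun N hN => ?_)
  rw [hS] at hN
  exact hN e he

/-- The variety generated by a class `C` of monoids: all monoids satisfying every identity
that holds throughout `C`. -/
def generatedBy (C : Set MonCat.{0}) : MonoidVariety :=
  ofIdentities {e | ∀ M ∈ C, MonoidSatisfies M e}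

theorem subset_generatedBy (C : Set MonCat.{0}) : C ⊆ (generatedBy C).carrier :=
  fun M hM _ he => he M hM

/-- `generatedBy C` is the least variety containing `C`. -/
theorem generatedBy_le_iff (C : Set MonCat.{0}) (V : MonoidVariety) :
    generatedBy C ≤ V ↔ C ⊆ V.carrier := by
  constructor
  · intro h
    exact (subset_generatedBy C).trans h
  · intro h M hM
    exact V.mem_of_satisfies M (fun e he => hM e (fun N hN => he N (h hN)))

/-- The lattice of monoid varieties: the meet is the intersection, the join is the variety
generated by the union. -/
instance instLattice : Lattice MonoidVariety where
  inf V W := ⟨V.carrier ∩ W.carrier, by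
    obtain ⟨S, hS⟩ := V.equational
    obtain ⟨T, hT⟩ := W.equational
    refine ⟨S ∪ T, ?_⟩
    rw [hS, hT]
    ext M
    constructor
    · rintro ⟨h1, h2⟩ e (he | he)
      · exact h1 e he
      · exact h2 e he
    · intro h
      exact ⟨fun e he => h e (Or.inl he), fun e he => h e (Or.inr he)⟩⟩
  sup V W := generatedBy (V.carrier ∪ W.carrier)
  inf_le_left _ _ := fun _ h => h.1
  inf_le_right _ _ := fun _ h => h.2
  le_inf _ _ _ h1 h2 := fun _ h => ⟨h1 h, h2 h⟩
  le_sup_left _ _ := Set.subset_union_left.trans (subset_generatedBy _)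
  le_sup_right _ _ := Set.subset_union_right.trans (subset_generatedBy _)
  sup_le _ _ _ h1 h2 := (generatedBy_le_iff _ _).2 (Set.union_subset h1 h2)

/-- The variety `V` has a distributive subvariety lattice; the subvariety lattice is the
principal ideal `Set.Iic V` of the lattice of all monoid varieties. -/
def IsDistributive (V : MonoidVariety) : Prop :=
  ∀ X Y Z : Set.Iic V, X ⊓ (Y ⊔ Z) = (X ⊓ Y) ⊔ (X ⊓ Z)

/-- The fully invariant congruence on the free monoid corresponding to `V`. -/
def fic (V : MonoidVariety) : Con Word where
  r u v := V.Satisfies (u, v)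
  iseqv :=
    { refl := fun _ _ _ _ => rfl
      symm := fun h M hM φ => (h M hM φ).symm
      trans := fun h1 h2 M hM φ => (h1 M hM φ).trans (h2 M hM φ) }
  mul' := by
    intro a b c d h1 h2 M hM φ
    have e1 := h1 M hM φ
    have e2 := h2 M hM φ
    simp only [map_mul] at e1 e2 ⊢
    rw [e1, e2]

end MonoidVariety

/-- The Rees congruence of a two-sided ideal `I` of a monoid `S`: it collapses `I` to a point. -/
def reesCon {S : Type} [Monoid S] (I : Set S) (hI : ∀ a ∈ I, ∀ s, s * a ∈ I ∧ a * s ∈ I) :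
    Con S where
  r a b := a = b ∨ (a ∈ I ∧ b ∈ I)
  iseqv :=
    { refl := fun _ => Or.inl rfl
      symm := by
        rintro a b (h | ⟨h1, h2⟩)
        · exact Or.inl h.symm
        · exact Or.inr ⟨h2, h1⟩
      trans := by
        rintro a b c (rfl | ⟨h1, h2⟩) (rfl | ⟨h3, h4⟩)
        · exact Or.inl rfl
        · exact Or.inr ⟨h3, h4⟩
        · exact Or.inr ⟨h1, h2⟩
        · exact Or.inr ⟨h1, h4⟩ }
  mul' := by
    rintro a b c d (rfl | ⟨h1, h2⟩) (rfl | ⟨h3, h4⟩)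
    · exact Or.inl rfl
    · exact Or.inr ⟨(hI _ h3 _).1, (hI _ h4 _).1⟩
    · exact Or.inr ⟨(hI _ h1 _).2, (hI _ h2 _).2⟩
    · exact Or.inr ⟨(hI _ h1 _).2, (hI _ h2 _).2⟩

/-- The closure of a set of `α`-classes under taking factors. -/
def factorClosure (α : Con Word) (W : Set α.Quotient) : Set α.Quotient :=
  {v | ∃ u ∈ W, ∃ p s : α.Quotient, u = p * v * s}

theorem factorClosure_compl_ideal (α : Con Word) (W : Set α.Quotient) :
    ∀ a ∈ (factorClosure α W)ᶜ, ∀ s,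
      s * a ∈ (factorClosure α W)ᶜ ∧ a * s ∈ (factorClosure α W)ᶜ := by
  intro a ha s
  constructor
  · rintro ⟨u, hu, p, q, h⟩
    exact ha ⟨u, hu, p * s, q, by rw [h]; simp only [mul_assoc]⟩
  · rintro ⟨u, hu, p, q, h⟩
    exact ha ⟨u, hu, p, s * q, by rw [h]; simp only [mul_assoc]⟩

/-- `M_α(W)`: the Rees quotient of the monoid of `α`-classes over the ideal of all classes
that are not factors of a class in `W`. -/
abbrev SapirMonoid (α : Con Word) (W : Set α.Quotient) : Type :=
  (reesCon (factorClosure α W)ᶜ (factorClosure_compl_ideal α W)).Quotient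

/-- The variety generated by the monoid `M_α(W)`. -/
def sapirVariety (α : Con Word) (W : Set α.Quotient) : MonoidVariety :=
  MonoidVariety.generatedBy {MonCat.of (SapirMonoid α W)}

/-- The letter `x` as a word. -/
def wx : Word := FreeMonoid.of Letter.x
/-- The letter `y i` as a word. -/
def wy (i : ℕ) : Word := FreeMonoid.of (Letter.y i)
/-- The letter `z i` as a word. -/
def wz (i : ℕ) : Word := FreeMonoid.of (Letter.z i)
/-- The letter `t i` as a word. -/
def wt (i : ℕ) : Word := FreeMonoid.of (Letter.t i)

/-- The identities `xyx² ≈ x²yx`, `x²y² ≈ y²x²` and `xzxyty ≈ xzyxty`. -/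
def alphaOneIdentities : Set MonoidIdentity :=
  {(wx * wy 0 * wx ^ 2, wx ^ 2 * wy 0 * wx),
   (wx ^ 2 * wy 0 ^ 2, wy 0 ^ 2 * wx ^ 2),
   (wx * wz 0 * wx * wy 0 * wt 0 * wy 0, wx * wz 0 * wy 0 * wx * wt 0 * wy 0)}

/-- The congruence `α₁`. -/
def alphaOne : Con Word := (MonoidVariety.ofIdentities alphaOneIdentities).fic

/-- The aperiodic version of `α₁`, in which the identity `x² ≈ x³` is added. -/
def alphaOneAperiodic : Con Word :=
  (MonoidVariety.ofIdentities (insert (wx ^ 2, wx ^ 3) alphaOneIdentities)).fic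

/-- The word
`a_{n,m}[ρ] = (∏_{i=1}^n z_i t_i) x (∏_{i=1}^{n+m-1} z_{iρ} y_i²) z_{(n+m)ρ} x
(∏_{i=n+1}^{n+m} t_i z_i)`.
The permuted set `{1, …, n+m}` is represented by `Fin (n + m)`, so that `i : Fin (n + m)` stands
for the number `i + 1`; the letters keep the indices `1, …, n+m`. -/
def aWord (n m : ℕ) (ρ : Equiv.Perm (Fin (n + m))) : Word :=
  ((List.range n).map fun i => wz (i + 1) * wt (i + 1)).prod * wx *
    ((List.finRange (n + m)).map fun i =>
      wz ((ρ i : ℕ) + 1) * (if (i : ℕ) + 1 < n + m then wy ((i : ℕ) + 1) ^ 2 else 1)).prod * wx *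
    ((List.range m).map fun i => wt (n + i + 1) * wz (n + i + 1)).prod

/-- The set of all permutations of `{1, …, 2k}` that map `{1, …, k}` into `{k+1, …, 2k}` and
`{k+1, …, 2k}` into `{1, …, k}`. -/
def sharpPerm (k : ℕ) : Set (Equiv.Perm (Fin (k + k))) :=
  {π | (∀ i : Fin (k + k), (i : ℕ) < k → k ≤ (π i : ℕ)) ∧
       (∀ i : Fin (k + k), k ≤ (i : ℕ) → (π i : ℕ) < k)}

/-- The variety generated by `M_α([a_{k,k}[π]]^α)`. -/
def aVariety (α : Con Word) (k : ℕ) (π : Equiv.Perm (Fin (k + k))) : MonoidVariety :=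
  sapirVariety α {((aWord k k π : Word) : α.Quotient)}

/-!
Let `V` be a variety and let `C₁`, `C₂` be unions of classes of its fully invariant congruence.
Suppose that `e₁` does not lead out of `C₁`, that `e₂` does not lead out of `C₂`, and that `e₀` does
not lead out of `C₁ ∩ C₂`. The syntactic monoids of these languages then lie in the respective
subvarieties `V₁`, `V₂`, `V₀` of `V`, and that of `C₁ ∩ C₂` lies in `V₀ ⊓ (V₁ ⊔ V₂)`. So the
distributive law fails as soon as an identity that leads out of `C₁ ∩ C₂` follows from `e₀` and `e₁`
as well as from `e₀` and `e₂`.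

For `α₁`, no identity of the variety of `a_{k,k}[π]` relates one of the words `x²y`, `xyx`, `yx²` to
another word, so `C₁ = {x²y, xyx}` and `C₂ = {xyx, yx²}` are such unions, and the three identities
between these words do the job.

For `α₁°`, the letters `ξ` and `ξ'` are inserted twice each, among other new letters, around the
core of `a_{k,k}[π]`, in a word `w(ξ, ξ')`, and
`e₀ : w(ξ, ξ'²) ≈ w(ξ², ξ'²)`, `e₁ : w(ξ, ξ') ≈ w(ξ, ξ'²)`, `e₂ : w(ξ, ξ') ≈ w(ξ², ξ')`.
Here `e₂` is itself the required consequence, since the substitution `ξ ↦ ξ²` in `e₁` yields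
`w(ξ², ξ') ≈ w(ξ², ξ'²)`. In the words of `C₁` the letters that are rigid modulo `α₁°` are arranged
as in `w(ξ, ξ')`, and `ξ` enters before the new letter `ν`; `C₂` is the mirror image of `C₁`.
Suppose that a substitution turns `w(ξ, ξ')` into a factor of a word of `C₁`. In this word the two
occurrences of `ξ` alternate with those of `ν` and with those of each letter `z_j` of the last
product, and the last occurrences of these letters are pairwise separated by letters occurring once.
If the image of `ξ'` contained `ξ`, then the letters `ν` and `z_j` would have to come from images of
pairwise distinct letters that occur in `w(ξ, ξ')` both between and behind the two `ξ'`; but only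
the letters `z_j` do, which are too few. So the image of `ξ'` can be doubled. The same holds for `ξ`
in place of `ξ'` in a word of `C₁ ∩ C₂`.
-/

section OccurrenceOrders

variable {α β : Type*} [DecidableEq α] [DecidableEq β] {u v p q : List α} {c d e : α}

/-- The first occurrence of `c` in the word `u` precedes every occurrence of `d`; in particular
`c` occurs in `u`. -/
def FirstLT (u : List α) (c d : α) : Prop := u.idxOf c < u.idxOf d

/-- The last occurrence of `d` in the word `u` follows every occurrence of `c`; in particular
`d` occurs in `u`. -/
def LastLT (u : List α) (c d : α) : Prop := FirstLT u.reverse d c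

theorem FirstLT.mem (h : FirstLT u c d) : c ∈ u :=
  List.idxOf_lt_length_iff.1 (h.trans_le List.idxOf_le_length)

theorem LastLT.mem (h : LastLT u c d) : d ∈ u :=
  List.mem_reverse.1 (FirstLT.mem h)

theorem FirstLT.ne (h : FirstLT u c d) : c ≠ d := by
  rintro rfl
  exact lt_irrefl _ h

theorem LastLT.ne (h : LastLT u c d) : c ≠ d :=
  (FirstLT.ne h).symm

theorem FirstLT.trans (hcd : FirstLT u c d) (hde : FirstLT u d e) : FirstLT u c e :=
  lt_trans hcd hde

theorem LastLT.trans (hcd : LastLT u c d) (hde : LastLT u d e) : LastLT u c e :=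
  FirstLT.trans hde hcd

theorem FirstLT.not_firstLT (h : FirstLT u c d) : ¬ FirstLT u d c :=
  lt_asymm h

theorem LastLT.not_lastLT (h : LastLT u c d) : ¬ LastLT u d c :=
  FirstLT.not_firstLT h

theorem firstLT_or_firstLT (hc : c ∈ u) (hcd : c ≠ d) : FirstLT u c d ∨ FirstLT u d c :=
  lt_or_gt_of_ne fun h => hcd ((List.idxOf_inj hc).1 h)

theorem firstLT_of_mem_of_not_mem (hc : c ∈ u) (hd : d ∉ u) : FirstLT u c d := by
  rw [FirstLT, List.idxOf_of_notMem hd]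
  exact List.idxOf_lt_length_iff.2 hc

theorem lastLT_of_mem_of_not_mem (hc : c ∉ u) (hd : d ∈ u) : LastLT u c d :=
  firstLT_of_mem_of_not_mem (List.mem_reverse.2 hd) (mt List.mem_reverse.1 hc)

theorem firstLT_append :
    FirstLT (u ++ v) c d ↔ FirstLT u c d ∨ (c ∉ u ∧ d ∉ u ∧ FirstLT v c d) := by
  have hc := @List.idxOf_lt_length_iff _ _ _ u c
  have hd := @List.idxOf_lt_length_iff _ _ _ u d
  have hc' := @List.idxOf_le_length _ _ _ u c
  have hd' := @List.idxOf_le_length _ _ _ u d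
  by_cases c ∈ u <;> by_cases d ∈ u <;> simp_all [FirstLT, List.idxOf_append] <;> omega

theorem firstLT_reverse : FirstLT u.reverse c d ↔ LastLT u d c :=
  Iff.rfl

theorem lastLT_reverse : LastLT u.reverse c d ↔ FirstLT u d c := by
  rw [LastLT, List.reverse_reverse]

theorem lastLT_append :
    LastLT (u ++ v) c d ↔ LastLT v c d ∨ (c ∉ v ∧ d ∉ v ∧ LastLT u c d) := by
  rw [LastLT, List.reverse_append, firstLT_append, List.mem_reverse, List.mem_reverse]
  exact or_congr_right and_left_comm

theorem firstLT_singleton : FirstLT [e] c d ↔ c = e ∧ d ≠ e := by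
  by_cases hc : e = c <;> by_cases hd : e = d <;>
    simp only [FirstLT, List.idxOf_cons, List.idxOf_nil, hc, hd, beq_self_eq_true] <;> grind

theorem firstLT_cons :
    FirstLT (e :: u) c d ↔ (c = e ∧ d ≠ e) ∨ (c ≠ e ∧ d ≠ e ∧ FirstLT u c d) := by
  rw [← List.singleton_append, firstLT_append, firstLT_singleton, List.mem_singleton,
    List.mem_singleton]

theorem FirstLT.not_mem_of_not_mem (h : FirstLT (p ++ q) c d) (hc : c ∉ p) : d ∉ p := by
  rcases firstLT_append.1 h with h | h
  · exact absurd h.mem hc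
  · exact h.2.1

theorem LastLT.not_mem_of_not_mem (h : LastLT (p ++ q) c d) (hd : d ∉ q) : c ∉ q := by
  rcases lastLT_append.1 h with h | h
  · exact absurd h.mem hd
  · exact h.1

theorem LastLT.of_append (h : LastLT (p ++ q) c d) (hd : d ∉ q) : LastLT p c d := by
  rcases lastLT_append.1 h with h | h
  · exact absurd h.mem hd
  · exact h.2.2

theorem FirstLT.append_right (h : FirstLT p c d) (q : List α) : FirstLT (p ++ q) c d :=
  firstLT_append.2 (Or.inl h)

theorem LastLT.append_left (h : LastLT q c d) (p : List α) : LastLT (p ++ q) c d :=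
  lastLT_append.2 (Or.inl h)

theorem firstLT_append_of_mem (hc : c ∈ p) (hd : d ∉ p) : FirstLT (p ++ q) c d :=
  (firstLT_of_mem_of_not_mem hc hd).append_right q

theorem lastLT_append_of_mem (hc : c ∉ q) (hd : d ∈ q) : LastLT (p ++ q) c d :=
  (lastLT_of_mem_of_not_mem hc hd).append_left p

theorem firstLT_flatMap {φ : α → List β} {c' d' : β} (hcd : c ≠ d)
    (hc : ∀ e, c' ∈ φ e ↔ e = c) (hd : ∀ e, d' ∈ φ e ↔ e = d) :
    FirstLT (u.flatMap φ) c' d' ↔ FirstLT u c d := by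
  induction u with
  | nil => exact Iff.rfl
  | cons e u ih =>
    have hhead : FirstLT (φ e) c' d' ↔ c = e ∧ d ≠ e := by
      refine ⟨fun h => ?_, fun ⟨hce, hde⟩ => ?_⟩
      · have hce := (hc e).1 h.mem
        exact ⟨hce.symm, hce ▸ hcd.symm⟩
      · exact firstLT_of_mem_of_not_mem ((hc e).2 hce.symm) (mt (hd e).1 hde.symm)
    rw [List.flatMap_cons, firstLT_append, firstLT_cons, hhead, hc, hd, ih, eq_comm (a := e),
      eq_comm (a := e)]

theorem lastLT_flatMap {φ : α → List β} {c' d' : β} (hcd : c ≠ d)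
    (hc : ∀ e, c' ∈ φ e ↔ e = c) (hd : ∀ e, d' ∈ φ e ↔ e = d) :
    LastLT (u.flatMap φ) c' d' ↔ LastLT u c d := by
  rw [LastLT, List.reverse_flatMap]
  refine firstLT_flatMap hcd.symm (fun e => ?_) (fun e => ?_) <;>
    simp only [Function.comp_apply, List.mem_reverse, hc, hd]

end OccurrenceOrders

section NondistributivityCriterion

open FreeMonoid

/-- The syntactic congruence of a language `C`: two words are congruent when they can be replaced
by each other in every context without changing membership in `C`. -/
def syntacticCon (C : Set Word) : Con Word where
  r u v := ∀ l r, l * u * r ∈ C ↔ l * v * r ∈ C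
  iseqv :=
    { refl := fun _ _ _ => Iff.rfl
      symm := fun h l r => (h l r).symm
      trans := fun h₁ h₂ l r => (h₁ l r).trans (h₂ l r) }
  mul' := fun {_ b c _} h₁ h₂ l r => by
    have h₁ := h₁ l (c * r)
    have h₂ := h₂ (l * b) r
    simp only [mul_assoc] at h₁ h₂ ⊢
    exact h₁.trans h₂

/-- The language `C` is stable under the identity `u ≈ v`: rewriting a factor of a word by the
identity does not change membership in `C`. -/
def Stable (C : Set Word) (u v : Word) : Prop :=
  ∀ (θ : Letter → Word) (l r : Word), l * lift θ u * r ∈ C ↔ l * lift θ v * r ∈ C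

theorem Stable.mem_iff {C : Set Word} {u v : Word} (h : Stable C u v) : u ∈ C ↔ v ∈ C := by
  have hid : lift (of : Letter → Word) = MonoidHom.id Word := lift_restrict (MonoidHom.id Word)
  simpa only [hid, MonoidHom.id_apply, one_mul, mul_one] using h of 1 1

theorem Stable.inter {C D : Set Word} {u v : Word} (hC : Stable C u v) (hD : Stable D u v) :
    Stable (C ∩ D) u v :=
  fun θ l r => and_congr (hC θ l r) (hD θ l r)

theorem conQuotient_satisfies_iff {c : Con Word} {u v : Word} :
    MonoidSatisfies c.Quotient (u, v) ↔ ∀ θ : Letter → Word, c (lift θ u) (lift θ v) := by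
  refine ⟨fun h θ => c.eq.1 ?_, fun h φ => ?_⟩
  · have h := h (c.mk' ∘ θ)
    rwa [← hom_map_lift, ← hom_map_lift] at h
  · obtain ⟨θ, rfl⟩ : ∃ θ : Letter → Word, c.mk' ∘ θ = φ :=
      ⟨fun a => (c.mk'_surjective (φ a)).choose,
        funext fun a => (c.mk'_surjective (φ a)).choose_spec⟩
    rw [← hom_map_lift, ← hom_map_lift]
    exact c.eq.2 (h θ)

theorem syntacticQuotient_satisfies_iff {C : Set Word} {u v : Word} :
    MonoidSatisfies (syntacticCon C).Quotient (u, v) ↔ Stable C u v :=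
  conQuotient_satisfies_iff

namespace MonoidVariety

variable {V W : MonoidVariety} {C D : Set Word} {u v : Word}

theorem fic_ofIdentities {S : Set MonoidIdentity} (h : (u, v) ∈ S) : (ofIdentities S).fic u v :=
  fun _ hM => hM _ h

theorem fic_context (h : V.fic u v) (θ : Letter → Word) (l r : Word) :
    V.fic (l * lift θ u * r) (l * lift θ v * r) := by
  refine V.fic.mul (V.fic.mul (V.fic.refl l) fun M hM φ => ?_) (V.fic.refl r)
  have h := h M hM (lift φ ∘ θ)
  rwa [← hom_map_lift, ← hom_map_lift] at h

/-- The language `C` is a union of classes of the fully invariant congruence of `V`. -/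
def Saturated (V : MonoidVariety) (C : Set Word) : Prop :=
  ∀ ⦃u v⦄, V.fic u v → u ∈ C → v ∈ C

theorem Saturated.stable (h : V.Saturated C) (huv : V.fic u v) : Stable C u v := by
  intro θ l r
  exact ⟨h (fic_context huv θ l r), h (V.fic.symm (fic_context huv θ l r))⟩

theorem Saturated.inter (hC : V.Saturated C) (hD : V.Saturated D) : V.Saturated (C ∩ D) :=
  fun _ _ huv h => ⟨hC huv h.1, hD huv h.2⟩

theorem Saturated.syntacticQuotient_mem (h : V.Saturated C) :
    MonCat.of (syntacticCon C).Quotient ∈ V.carrier :=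
  V.mem_of_satisfies _ fun _ he => syntacticQuotient_satisfies_iff.2 (h.stable he)

theorem mem_ofIdentities_singleton {M : MonCat.{0}} {e : MonoidIdentity} :
    M ∈ (ofIdentities {e}).carrier ↔ MonoidSatisfies M e :=
  ⟨fun h => h e rfl, fun h _ he => he ▸ h⟩

theorem syntacticQuotient_inter_mem_sup (hC : MonCat.of (syntacticCon C).Quotient ∈ V.carrier)
    (hD : MonCat.of (syntacticCon D).Quotient ∈ W.carrier) :
    MonCat.of (syntacticCon (C ∩ D)).Quotient ∈ (V ⊔ W).carrier := by
  refine mem_of_satisfies _ _ fun e he => syntacticQuotient_satisfies_iff.2 (Stable.inter ?_ ?_)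
  · exact syntacticQuotient_satisfies_iff.1 (he _ (le_sup_left (a := V) hC))
  · exact syntacticQuotient_satisfies_iff.1 (he _ (le_sup_right (a := V) hD))

/-- The subvarieties of `V` given by `e₀`, `e₁`, `e₂` violate the distributive law: the syntactic
monoid of `C₁ ∩ C₂` lies in `V₀ ⊓ (V₁ ⊔ V₂)`, but `u ≈ v` fails in it, whereas `u ≈ v` holds in
both `V₀ ⊓ V₁` and `V₀ ⊓ V₂`. -/
theorem not_isDistributive_of_saturated {e₀ e₁ e₂ : MonoidIdentity} {C₁ C₂ : Set Word}
    (hC₁ : V.Saturated C₁) (hC₂ : V.Saturated C₂) (he₁ : Stable C₁ e₁.1 e₁.2)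
    (he₂ : Stable C₂ e₂.1 e₂.2) (he₀ : Stable (C₁ ∩ C₂) e₀.1 e₀.2)
    (hu : u ∈ C₁ ∩ C₂) (hv : v ∉ C₁ ∩ C₂)
    (h₁ : ∀ M : MonCat.{0}, MonoidSatisfies M e₀ → MonoidSatisfies M e₁ →
      MonoidSatisfies M (u, v))
    (h₂ : ∀ M : MonCat.{0}, MonoidSatisfies M e₀ → MonoidSatisfies M e₂ →
      MonoidSatisfies M (u, v)) :
    ¬ V.IsDistributive := by
  intro hdistrib
  let sub (e : MonoidIdentity) : MonoidVariety := V ⊓ ofIdentities {e}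
  have hle (e : MonoidIdentity) : sub e ∈ Set.Iic V := Set.mem_Iic.2 inf_le_left
  have hlaw : sub e₀ ⊓ (sub e₁ ⊔ sub e₂) = (sub e₀ ⊓ sub e₁) ⊔ (sub e₀ ⊓ sub e₂) :=
    congrArg Subtype.val (hdistrib ⟨sub e₀, hle e₀⟩ ⟨sub e₁, hle e₁⟩ ⟨sub e₂, hle e₂⟩)
  have hsub {C : Set Word} {e : MonoidIdentity} (hC : V.Saturated C) (he : Stable C e.1 e.2) :
      MonCat.of (syntacticCon C).Quotient ∈ (sub e).carrier :=
    ⟨hC.syntacticQuotient_mem,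
      mem_ofIdentities_singleton.2 (syntacticQuotient_satisfies_iff.2 he)⟩
  have hmem : MonCat.of (syntacticCon (C₁ ∩ C₂)).Quotient ∈
      (sub e₀ ⊓ (sub e₁ ⊔ sub e₂)).carrier :=
    ⟨hsub (hC₁.inter hC₂) he₀, syntacticQuotient_inter_mem_sup (hsub hC₁ he₁) (hsub hC₂ he₂)⟩
  have hsat : MonoidSatisfies (syntacticCon (C₁ ∩ C₂)).Quotient (u, v) := by
    rw [hlaw] at hmem
    refine hmem (u, v) ?_
    rintro M (⟨hM₀, hM⟩ | ⟨hM₀, hM⟩)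
    · exact h₁ M (mem_ofIdentities_singleton.1 hM₀.2) (mem_ofIdentities_singleton.1 hM.2)
    · exact h₂ M (mem_ofIdentities_singleton.1 hM₀.2) (mem_ofIdentities_singleton.1 hM.2)
  exact hv ((syntacticQuotient_satisfies_iff.1 hsat).mem_iff.1 hu)

end MonoidVariety

theorem sapirVariety_context {α : Con Word} {w u v : Word}
    (huv : (sapirVariety α {(w : α.Quotient)}).fic u v) {θ : Letter → Word} {l r : Word}
    (hu : α (l * lift θ u * r) w) : α (l * lift θ v * r) w := by
  set W : Set α.Quotient := {(w : α.Quotient)}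
  let c := reesCon (factorClosure α W)ᶜ (factorClosure_compl_ideal α W)
  have hrees := MonoidVariety.fic_context huv θ l r _ (MonoidVariety.subset_generatedBy _ rfl)
    ((c.mk'.comp α.mk') ∘ of)
  rw [lift_restrict] at hrees
  rcases c.eq.1 hrees with h | h
  · exact α.trans (α.symm (α.eq.1 h)) hu
  · exact absurd ⟨_, rfl, 1, 1, by rw [one_mul, mul_one]; exact (α.eq.2 hu).symm⟩ h.1

end NondistributivityCriterion

section RigidLetters

variable {α : Type*} [DecidableEq α] {u v w l r p q P Q W M : List α} {c d η : α}

theorem mem_left_or_mem_middle_of_surrounds (hc : c ∈ W)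
    (hcount : (p ++ W ++ M ++ W ++ q).count c = 2) (hη : η ∈ p ++ W ++ M ++ W ++ q)
    (hcd : FirstLT (p ++ W ++ M ++ W ++ q) c d) (hηd : ¬ FirstLT (p ++ W ++ M ++ W ++ q) η d)
    (hηc : LastLT (p ++ W ++ M ++ W ++ q) η c) : d ∉ p ∧ (d ∈ W ∨ d ∈ M) := by
  have hW : 0 < W.count c := List.count_pos_iff.2 hc
  simp only [List.count_append] at hcount
  have hp : c ∉ p := List.count_eq_zero.1 (by omega)
  have hq : c ∉ q := List.count_eq_zero.1 (by omega)
  have hηq : η ∉ q := hηc.not_mem_of_not_mem hq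
  simp only [List.append_assoc] at hcd hηd
  have hdp : d ∉ p := hcd.not_mem_of_not_mem hp
  refine ⟨hdp, ?_⟩
  by_contra! hd
  refine hηd ?_
  rw [← List.append_assoc, ← List.append_assoc]
  refine firstLT_append_of_mem ?_ ?_ <;>
    simp only [List.mem_append] at hη ⊢ <;> tauto

/-- The letters of `u` whose position relative to all other letters is shared by all words of the
class of `u` modulo `alphaOneAperiodic`: those occurring once, and those occurring twice such that
the first occurrence of a rigid letter `d` and, not before it, the last occurrence of a letter `η`
lie between the two occurrences. -/
inductive Rigid (u : List α) : α → Prop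
  | once {c : α} (hcount : u.count c = 1) : Rigid u c
  | twice {c d η : α} (hcount : u.count c = 2) (hd : Rigid u d) (hη : η ∈ u)
      (hcd : FirstLT u c d) (hηd : ¬ FirstLT u η d) (hηc : LastLT u η c) : Rigid u c

theorem Rigid.mem (h : Rigid u c) : c ∈ u := by
  cases h with
  | once hcount => exact List.count_pos_iff.1 (by omega)
  | twice hcount => exact List.count_pos_iff.1 (by omega)

theorem Rigid.not_mem_square (h : Rigid (p ++ (W ++ W) ++ q) c) : c ∉ W := by
  induction h with
  | once hcount =>
    intro hc
    have hW := List.count_pos_iff.2 hc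
    simp only [List.count_append] at hcount
    omega
  | twice hcount _ hη hcd hηd hηc ih =>
    intro hc
    have hassoc : p ++ (W ++ W) ++ q = p ++ W ++ [] ++ W ++ q := by simp
    rw [hassoc] at hcount hη hcd hηd hηc
    rcases (mem_left_or_mem_middle_of_surrounds hc hcount hη hcd hηd hηc).2 with hd | hd
    · exact ih hd
    · exact List.not_mem_nil hd

/-- The words `u` and `v` have the same letters, and the rigid letters of `u` have in `v` the same
numbers of occurrences and the same positions relative to all other letters as in `u`. -/
structure SameRigid (u v : List α) : Prop where
  mem_iff : ∀ c, c ∈ v ↔ c ∈ u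
  count_eq : ∀ ⦃c⦄, Rigid u c → v.count c = u.count c
  firstLT_iff : ∀ ⦃c⦄, Rigid u c → ∀ d, FirstLT v c d ↔ FirstLT u c d
  lastLT_iff : ∀ ⦃c⦄, Rigid u c → ∀ d, LastLT v c d ↔ LastLT u c d

namespace SameRigid

theorem refl (u : List α) : SameRigid u u :=
  ⟨fun _ => Iff.rfl, fun _ _ => rfl, fun _ _ _ => Iff.rfl, fun _ _ _ => Iff.rfl⟩

theorem firstLT_iff' (h : SameRigid u v) (hd : Rigid u d) (c : α) :
    FirstLT v c d ↔ FirstLT u c d := by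
  have hu := firstLT_or_firstLT (d := c) hd.mem
  have hv := firstLT_or_firstLT (d := c) ((h.mem_iff d).2 hd.mem)
  have hiff := h.firstLT_iff hd c
  exact ⟨fun hc => (hu hc.ne.symm).resolve_left fun h' => hc.not_firstLT (hiff.2 h'),
    fun hc => (hv hc.ne.symm).resolve_left fun h' => hc.not_firstLT (hiff.1 h')⟩

theorem lastLT_iff' (h : SameRigid u v) (hd : Rigid u d) (c : α) :
    LastLT v c d ↔ LastLT u c d := by
  have hu := firstLT_or_firstLT (d := c) (List.mem_reverse.2 hd.mem)
  have hv := firstLT_or_firstLT (d := c) (List.mem_reverse.2 ((h.mem_iff d).2 hd.mem))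
  have hiff := h.lastLT_iff hd c
  exact ⟨fun hc => (hu hc.ne.symm).resolve_right fun h' => hc.not_lastLT (hiff.2 h'),
    fun hc => (hv hc.ne.symm).resolve_right fun h' => hc.not_lastLT (hiff.1 h')⟩

theorem rigid (h : SameRigid u v) (hc : Rigid u c) : Rigid v c := by
  have hcount := h.count_eq hc
  induction hc with
  | once hu => exact .once (hcount.trans hu)
  | twice hu hd hη hcd hηd hηc ih =>
    have hc := Rigid.twice hu hd hη hcd hηd hηc
    exact .twice (hcount.trans hu) (ih (h.count_eq hd)) ((h.mem_iff _).2 hη)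
      ((h.firstLT_iff hc _).2 hcd) (mt (h.firstLT_iff' hd _).1 hηd) ((h.lastLT_iff' hc _).2 hηc)

theorem replace_of_orders (h : SameRigid w (l ++ P ++ r)) (hcount : ∀ c, Q.count c = P.count c)
    (hfirst : ∀ c d, FirstLT Q c d ↔ FirstLT P c d)
    (hlast : ∀ c d, LastLT Q c d ↔ LastLT P c d) : SameRigid w (l ++ Q ++ r) := by
  have hPQ (c : α) : c ∈ Q ↔ c ∈ P := by
    rw [← List.count_pos_iff, hcount, List.count_pos_iff]
  refine ⟨fun c => ?_, fun c hc => ?_, fun c hc d => ?_, fun c hc d => ?_⟩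
  · rw [← h.mem_iff]
    simp only [List.mem_append, hPQ]
  · rw [← h.count_eq hc]
    simp only [List.count_append, hcount]
  · rw [← h.firstLT_iff hc]
    simp only [firstLT_append, List.mem_append, hPQ, hfirst]
  · rw [← h.lastLT_iff hc]
    simp only [lastLT_append, hPQ, hlast]

theorem replace_of_not_rigid (h : SameRigid w (l ++ P ++ r)) (hPQ : ∀ c, c ∈ Q ↔ c ∈ P)
    (hP : ∀ ⦃c⦄, Rigid (l ++ P ++ r) c → c ∉ P) : SameRigid w (l ++ Q ++ r) where
  mem_iff c := by
    rw [← h.mem_iff]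
    simp only [List.mem_append, hPQ]
  count_eq c hc := by
    have hcP := hP (h.rigid hc)
    rw [← h.count_eq hc]
    simp only [List.count_append, List.count_eq_zero_of_not_mem hcP,
      List.count_eq_zero_of_not_mem (mt (hPQ c).1 hcP)]
  firstLT_iff c hc d := by
    have hcP := hP (h.rigid hc)
    have hPcd : ¬ FirstLT P c d := fun h => hcP h.mem
    have hQcd : ¬ FirstLT Q c d := fun h => hcP ((hPQ c).1 h.mem)
    rw [← h.firstLT_iff hc]
    simp only [firstLT_append, List.mem_append, hPQ, hPcd, hQcd]
  lastLT_iff c hc d := by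
    have hcP := hP (h.rigid hc)
    have hPcd : LastLT P c d ↔ d ∈ P := ⟨LastLT.mem, lastLT_of_mem_of_not_mem hcP⟩
    have hQcd : LastLT Q c d ↔ d ∈ P :=
      ⟨fun h => (hPQ d).1 h.mem, fun h => lastLT_of_mem_of_not_mem (mt (hPQ c).1 hcP) ((hPQ d).2 h)⟩
    rw [← h.lastLT_iff hc]
    simp only [lastLT_append, hPQ, hPcd, hQcd]

end SameRigid

end RigidLetters

section AperiodicInvariance

open FreeMonoid

theorem toList_lift (θ : Letter → Word) (u : Word) :
    toList (lift θ u) = (toList u).flatMap fun a => toList (θ a) := by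
  induction u using FreeMonoid.inductionOn' with
  | one => rfl
  | of_mul a u ih => rw [map_mul, lift_eval_of, toList_mul, ih, toList_of_mul, List.flatMap_cons]

theorem stable_of_forall_flatMap {C : List Letter → Prop} {u v : List Letter}
    (h : ∀ (θ : Letter → List Letter) l r, C (l ++ u.flatMap θ ++ r) ↔ C (l ++ v.flatMap θ ++ r)) :
    Stable {U | C (toList U)} (ofList u) (ofList v) := by
  intro θ l r
  have hlift (u : List Letter) : toList (l * lift θ (ofList u) * r) =
      toList l ++ u.flatMap (toList ∘ θ) ++ toList r := by
    rw [toList_mul, toList_mul, toList_lift, toList_ofList]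
    rfl
  rw [Set.mem_ofPred_eq, Set.mem_ofPred_eq, hlift, hlift]
  exact h _ _ _

theorem mem_iff_of_fic_ofIdentities {S : Set MonoidIdentity} {C : Set Word}
    (hC : ∀ e ∈ S, Stable C e.1 e.2) {u v : Word} (h : (MonoidVariety.ofIdentities S).fic u v) :
    u ∈ C ↔ v ∈ C :=
  (syntacticQuotient_satisfies_iff.1 (h (MonCat.of (syntacticCon C).Quotient)
    fun e he => syntacticQuotient_satisfies_iff.2 (hC e he))).mem_iff

variable {α : Type*} [DecidableEq α] (w l r X Y Z T : List α)

theorem sameRigid_xyxx_iff : SameRigid w (l ++ (X ++ Y ++ (X ++ X)) ++ r) ↔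
    SameRigid w (l ++ (X ++ X ++ Y ++ X) ++ r) := by
  have hcount (c : α) : (X ++ Y ++ (X ++ X)).count c = (X ++ X ++ Y ++ X).count c := by
    simp only [List.count_append]
    omega
  have hfirst (c d : α) :
      FirstLT (X ++ Y ++ (X ++ X)) c d ↔ FirstLT (X ++ X ++ Y ++ X) c d := by
    simp only [firstLT_append, List.mem_append]
    grind
  have hlast (c d : α) : LastLT (X ++ Y ++ (X ++ X)) c d ↔ LastLT (X ++ X ++ Y ++ X) c d := by
    simp only [lastLT_append, List.mem_append]
    grind
  exact ⟨fun h => h.replace_of_orders (fun c => (hcount c).symm) (fun c d => (hfirst c d).symm)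
    fun c d => (hlast c d).symm, fun h => h.replace_of_orders hcount hfirst hlast⟩

theorem sameRigid_xzxyty_iff : SameRigid w (l ++ (X ++ Z ++ X ++ Y ++ T ++ Y) ++ r) ↔
    SameRigid w (l ++ (X ++ Z ++ Y ++ X ++ T ++ Y) ++ r) := by
  have hcount (c : α) :
      (X ++ Z ++ X ++ Y ++ T ++ Y).count c = (X ++ Z ++ Y ++ X ++ T ++ Y).count c := by
    simp only [List.count_append]
    omega
  have hfirst (c d : α) :
      FirstLT (X ++ Z ++ X ++ Y ++ T ++ Y) c d ↔ FirstLT (X ++ Z ++ Y ++ X ++ T ++ Y) c d := by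
    simp only [firstLT_append, List.mem_append]
    by_cases hX : FirstLT X c d <;> by_cases hc : c ∈ X <;> by_cases hd : d ∈ X <;>
      simp only [hX, hc, hd] <;> grind
  have hlast (c d : α) :
      LastLT (X ++ Z ++ X ++ Y ++ T ++ Y) c d ↔ LastLT (X ++ Z ++ Y ++ X ++ T ++ Y) c d := by
    simp only [lastLT_append]
    grind
  exact ⟨fun h => h.replace_of_orders (fun c => (hcount c).symm) (fun c d => (hfirst c d).symm)
    fun c d => (hlast c d).symm, fun h => h.replace_of_orders hcount hfirst hlast⟩

variable {w l r X Y} in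
theorem SameRigid.swap_squares (h : SameRigid w (l ++ (X ++ X ++ (Y ++ Y)) ++ r)) :
    SameRigid w (l ++ (Y ++ Y ++ (X ++ X)) ++ r) := by
  refine h.replace_of_not_rigid (fun c => by simp only [List.mem_append]; tauto) fun c hc => ?_
  have hX : c ∉ X := Rigid.not_mem_square (p := l) (q := Y ++ Y ++ r) (by simpa using hc)
  have hY : c ∉ Y := Rigid.not_mem_square (p := l ++ (X ++ X)) (q := r) (by simpa using hc)
  simp [hX, hY]

theorem sameRigid_square_cube_iff :
    SameRigid w (l ++ (X ++ X) ++ r) ↔ SameRigid w (l ++ (X ++ X ++ X) ++ r) := by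
  constructor <;> intro h
  · refine h.replace_of_not_rigid (fun c => by simp) fun c hc => ?_
    simpa using hc.not_mem_square
  · refine h.replace_of_not_rigid (fun c => by simp) fun c hc => ?_
    have hX : c ∉ X := Rigid.not_mem_square (p := l) (q := X ++ r) (by simpa using hc)
    simpa using hX

theorem stable_setOf_sameRigid (w : List Letter) (e : MonoidIdentity)
    (he : e ∈ insert (wx ^ 2, wx ^ 3) alphaOneIdentities) :
    Stable {u | SameRigid w (toList u)} e.1 e.2 := by
  intro θ l r
  rcases he with rfl | rfl | rfl | rfl <;>
    simp only [Set.mem_ofPred_eq, wx, wy, wz, wt, pow_succ, pow_zero, one_mul, map_mul,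
      lift_eval_of, toList_mul]
  · exact sameRigid_square_cube_iff ..
  · exact sameRigid_xyxx_iff ..
  · exact ⟨SameRigid.swap_squares, SameRigid.swap_squares⟩
  · exact sameRigid_xzxyty_iff ..

theorem SameRigid.of_alphaOneAperiodic {u v : Word} (h : alphaOneAperiodic u v) :
    SameRigid (toList u) (toList v) :=
  (mem_iff_of_fic_ofIdentities (stable_setOf_sameRigid (toList u)) h).1 (SameRigid.refl _)

end AperiodicInvariance

section AperiodicClass

open FreeMonoid

/-- The class of a word modulo `alphaOneAperiodic`. -/
def aperiodicClass (u : List Letter) : alphaOneAperiodic.Quotient :=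
  ((ofList u : Word) : alphaOneAperiodic.Quotient)

theorem aperiodicClass_eq_iff {u v : List Letter} :
    aperiodicClass u = aperiodicClass v ↔ alphaOneAperiodic (ofList u) (ofList v) :=
  alphaOneAperiodic.eq

theorem aperiodicClass_append (u v : List Letter) :
    aperiodicClass (u ++ v) = aperiodicClass u * aperiodicClass v :=
  rfl

theorem aperiodicClass_flatMap {β : Type*} (u : List β) (ψ : β → List Letter) :
    aperiodicClass (u.flatMap ψ) = (u.map fun c => aperiodicClass (ψ c)).prod := by
  induction u with
  | nil => rfl
  | cons c u ih =>
    rw [List.flatMap_cons, aperiodicClass_append, ih, List.map_cons, List.prod_cons]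

theorem aperiodicClass_flatMap_congr {β : Type*} {u : List β} {f g : β → List Letter}
    (h : ∀ b ∈ u, aperiodicClass (f b) = aperiodicClass (g b)) :
    aperiodicClass (u.flatMap f) = aperiodicClass (u.flatMap g) := by
  rw [aperiodicClass_flatMap, aperiodicClass_flatMap, List.map_congr_left h]

theorem aperiodicQuotient_satisfies {e : MonoidIdentity}
    (he : e ∈ insert (wx ^ 2, wx ^ 3) alphaOneIdentities) :
    MonoidSatisfies alphaOneAperiodic.Quotient e := by
  refine conQuotient_satisfies_iff.2 fun θ => ?_
  have h := MonoidVariety.fic_context (MonoidVariety.fic_ofIdentities he) θ 1 1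
  rw [one_mul, one_mul, mul_one, mul_one] at h
  exact h

theorem mul_self_mul_mul_self_comm (a b : alphaOneAperiodic.Quotient) :
    a * a * (b * b) = b * b * (a * a) := by
  have h := aperiodicQuotient_satisfies (Or.inr (Or.inr (Or.inl rfl)))
    (fun c => if c = .x then a else b)
  simpa [wx, wy, pow_succ] using h

theorem mul_self_eq_mul_self_mul (a : alphaOneAperiodic.Quotient) : a * a = a * a * a := by
  have h := aperiodicQuotient_satisfies (Or.inl rfl) (fun _ => a)
  simpa [wx, pow_succ] using h

theorem isIdempotentElem_of_isSquare {a : alphaOneAperiodic.Quotient} (h : IsSquare a) :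
    IsIdempotentElem a := by
  obtain ⟨b, rfl⟩ := h
  rw [IsIdempotentElem, ← mul_assoc, ← mul_self_eq_mul_self_mul, ← mul_self_eq_mul_self_mul]

theorem isSquare_mul {a b : alphaOneAperiodic.Quotient} (ha : IsSquare a) (hb : IsSquare b) :
    IsSquare (a * b) := by
  have hcomm : a * b = b * a := by
    obtain ⟨c, rfl⟩ := ha
    obtain ⟨d, rfl⟩ := hb
    exact mul_self_mul_mul_self_comm c d
  refine ⟨a * b, Eq.symm ?_⟩
  calc a * b * (a * b) = a * (b * a) * b := by simp only [mul_assoc]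
    _ = a * a * (b * b) := by rw [← hcomm]; simp only [mul_assoc]
    _ = a * b := by rw [isIdempotentElem_of_isSquare ha, isIdempotentElem_of_isSquare hb]

theorem isIdempotentElem_aperiodicClass_flatMap {u : List Letter} {ψ : Letter → List Letter}
    (h : ∀ c ∈ u, ∃ a, ψ c = a ++ a) : IsIdempotentElem (aperiodicClass (u.flatMap ψ)) := by
  refine isIdempotentElem_of_isSquare ?_
  induction u with
  | nil => exact ⟨1, (one_mul _).symm⟩
  | cons c u ih =>
    rw [List.flatMap_cons, aperiodicClass_append]
    obtain ⟨a, ha⟩ := h c List.mem_cons_self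
    refine isSquare_mul ⟨aperiodicClass a, ?_⟩ (ih fun d hd => h d (List.mem_cons_of_mem c hd))
    rw [ha, aperiodicClass_append]

end AperiodicClass

section Reversal

open FreeMonoid MulOpposite

theorem op_lift_reverse {M : Type} [Monoid M] (φ : Letter → M) (u : Word) :
    op (lift φ (ofList (toList u).reverse)) = lift (op ∘ φ) u := by
  induction u using FreeMonoid.inductionOn' with
  | one => rfl
  | of_mul a u ih =>
    rw [toList_of_mul, List.reverse_cons, ofList_append, map_mul, op_mul, ih, map_mul]
    rfl

theorem satisfies_mulOpposite_iff {M : Type} [Monoid M] {u v : List Letter} :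
    MonoidSatisfies Mᵐᵒᵖ (ofList u, ofList v) ↔
      MonoidSatisfies M (ofList u.reverse, ofList v.reverse) := by
  refine ⟨fun h φ => op_injective ?_, fun h φ => ?_⟩
  · have h := h (op ∘ φ)
    rwa [← op_lift_reverse, ← op_lift_reverse] at h
  · obtain ⟨φ, rfl⟩ : ∃ ψ : Letter → M, op ∘ ψ = φ := ⟨unop ∘ φ, rfl⟩
    rw [← op_lift_reverse, ← op_lift_reverse]
    exact congrArg op (h φ)

theorem mulOpposite_mem_aperiodic {M : Type} [Monoid M]
    (hM : MonCat.of M ∈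
      (MonoidVariety.ofIdentities (insert (wx ^ 2, wx ^ 3) alphaOneIdentities)).carrier) :
    MonCat.of Mᵐᵒᵖ ∈
      (MonoidVariety.ofIdentities (insert (wx ^ 2, wx ^ 3) alphaOneIdentities)).carrier := by
  have hlift {u v : Word} (h : (u, v) ∈ insert (wx ^ 2, wx ^ 3) alphaOneIdentities)
      (φ : Letter → M) : lift φ u = lift φ v := hM _ h φ
  rintro _ (rfl | rfl | rfl | rfl) φ
  · have h := hlift (Or.inl rfl) (unop ∘ φ)
    refine unop_injective ?_
    simpa [wx, pow_succ, mul_assoc] using h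
  · have h := hlift (Or.inr (Or.inl rfl)) (unop ∘ φ)
    refine unop_injective ?_
    simpa [wx, wy, pow_succ, mul_assoc] using h.symm
  · have h := hlift (Or.inr (Or.inr (Or.inl rfl))) (unop ∘ φ)
    refine unop_injective ?_
    simpa [wx, wy, pow_succ, mul_assoc] using h.symm
  · have h := hlift (Or.inr (Or.inr (Or.inr rfl)))
      (unop ∘ fun c => φ (if c = .x then .y 0 else if c = .y 0 then .x else
        if c = .z 0 then .t 0 else .z 0))
    refine unop_injective ?_
    simpa [wx, wy, wz, wt, mul_assoc] using h

theorem aperiodicClass_reverse {u v : List Letter} (h : aperiodicClass u = aperiodicClass v) :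
    aperiodicClass u.reverse = aperiodicClass v.reverse := by
  rw [aperiodicClass_eq_iff] at h ⊢
  exact fun M hM => satisfies_mulOpposite_iff.1 (h _ (mulOpposite_mem_aperiodic hM))

end Reversal

section SplitWords

open Letter

theorem count_flatMap_eq_count_map {β γ δ : Type*} [DecidableEq γ] [DecidableEq δ]
    {f : β → List γ} {g : β → δ} {c : γ} {d : δ} (h : ∀ b, (f b).count c = [g b].count d)
    (u : List β) : (u.flatMap f).count c = (u.map g).count d := by
  induction u with
  | nil => rfl
  | cons b u ih =>
    rw [List.flatMap_cons, List.count_append, ih, h, List.map_cons,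
      ← List.singleton_append (l := u.map g), List.count_append]

theorem count_mul_count_le_count_flatMap {β γ : Type*} [DecidableEq β] [DecidableEq γ]
    {f : β → List γ} {u : List β} {b : β} {c : γ} :
    u.count b * (f b).count c ≤ (u.flatMap f).count c := by
  induction u with
  | nil => simp
  | cons a u ih =>
    rw [List.flatMap_cons, List.count_append, List.count_cons, add_mul, add_comm]
    refine add_le_add ?_ ih
    split_ifs with hab
    · rw [beq_iff_eq.1 hab, one_mul]
    · rw [zero_mul]
      exact Nat.zero_le _

theorem count_le_count_flatMap {β γ : Type*} [DecidableEq γ] {f : β → List γ} {u : List β} {b : β}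
    (hb : b ∈ u) {c : γ} : (f b).count c ≤ (u.flatMap f).count c :=
  (List.sublist_flatten_of_mem (List.mem_map_of_mem (f := f) hb)).count_le c

/-- The parameters of a word
`∏_{i ∈ I} z_i t_i · x · ∏_{(j, m) ∈ F} z_j y_m² · z_κ y_h² z_ζ · ∏_{(i, m) ∈ L} y_m² z_i · x ·
∏_{j ∈ J} t_j z_j`, where `I = I₁, ζ, I₂` and `J = J₁, κ, J₂`. Of the letters between the two
occurrences of `x`, those before `y_h²` return in the last product and those behind it come from
the first one. -/
structure SplitWord where
  I₁ : List ℕ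
  I₂ : List ℕ
  J₁ : List ℕ
  J₂ : List ℕ
  ζ : ℕ
  κ : ℕ
  h : ℕ
  F : List (ℕ × ℕ)
  L : List (ℕ × ℕ)
  nodup : (I₁ ++ ζ :: I₂ ++ (J₁ ++ κ :: J₂)).Nodup
  perm_F : (F.map Prod.fst).Perm (J₁ ++ J₂)
  perm_L : (L.map Prod.fst).Perm (I₁ ++ I₂)
  h_ne : ∀ p ∈ F ++ L, p.2 ≠ h

namespace SplitWord

/-- The parameters of the reversed word. -/
def rev (S : SplitWord) : SplitWord where
  I₁ := S.J₂.reverse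
  I₂ := S.J₁.reverse
  J₁ := S.I₂.reverse
  J₂ := S.I₁.reverse
  ζ := S.κ
  κ := S.ζ
  h := S.h
  F := S.L.reverse
  L := S.F.reverse
  nodup := by simpa using List.nodup_reverse.2 S.nodup
  perm_F := by simpa using (List.reverse_perm _).trans (S.perm_L.trans (List.reverse_perm _).symm)
  perm_L := by simpa using (List.reverse_perm _).trans (S.perm_F.trans (List.reverse_perm _).symm)
  h_ne p hp := S.h_ne p (by simpa [or_comm] using hp)

variable (S : SplitWord) {i j : ℕ}

/-- The indices of the first product of the word. -/
def I : List ℕ := S.I₁ ++ S.ζ :: S.I₂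

/-- The indices of the last product of the word. -/
def J : List ℕ := S.J₁ ++ S.κ :: S.J₂

/-- The first product of the word. -/
def pre : List Letter := S.I.flatMap fun i => [z i, t i]

/-- The last product of the word. -/
def suf : List Letter := S.J.flatMap fun j => [t j, z j]

/-- The factor between the first `x` and `z_κ`. -/
def front : List Letter := S.F.flatMap fun p => [z p.1, y p.2, y p.2]

/-- The factor between `z_ζ` and the second `x`. -/
def back : List Letter := S.L.flatMap fun p => [y p.2, y p.2, z p.1]

/-- The factor between the two occurrences of `x`. -/
def core : List Letter := S.front ++ [z S.κ, y S.h, y S.h, z S.ζ] ++ S.back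

/-- The word given by the parameters. -/
def word : List Letter := S.pre ++ [x] ++ S.core ++ [x] ++ S.suf

theorem rev_pre : S.rev.pre = S.suf.reverse := by
  simp [pre, suf, rev, I, J, List.reverse_flatMap, Function.comp_def]

theorem rev_suf : S.rev.suf = S.pre.reverse := by
  simp [pre, suf, rev, I, J, List.reverse_flatMap, Function.comp_def]

theorem rev_core : S.rev.core = S.core.reverse := by
  simp [core, front, back, rev, List.reverse_flatMap, Function.comp_def]

theorem rev_word : S.rev.word = S.word.reverse := by
  simp [word, rev_pre, rev_core, rev_suf]

theorem mem_rev_I : i ∈ S.rev.I ↔ i ∈ S.J := by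
  simp only [I, J, rev, List.mem_append, List.mem_cons, List.mem_reverse]
  tauto

theorem mem_rev_J : i ∈ S.rev.J ↔ i ∈ S.I := by
  simp only [I, J, rev, List.mem_append, List.mem_cons, List.mem_reverse]
  tauto

theorem κ_mem_J : S.κ ∈ S.J := by
  simp [J]

theorem nodup_append : (S.I ++ S.J).Nodup :=
  S.nodup

variable {S}

theorem not_mem_J_of_mem_I (hi : i ∈ S.I) : i ∉ S.J :=
  fun hj => List.disjoint_of_nodup_append S.nodup_append hi hj

theorem κ_not_mem_I : S.κ ∉ S.I :=
  fun h => not_mem_J_of_mem_I h S.κ_mem_J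

theorem κ_not_mem_J₁_append_J₂ : S.κ ∉ S.J₁ ++ S.J₂ :=
  (List.nodup_cons.1 (List.nodup_middle.1 (List.nodup_append.1 S.nodup).2.1)).1

theorem mem_F_iff : (∃ p ∈ S.F, p.1 = j) ↔ j ∈ S.J₁ ++ S.J₂ := by
  rw [← S.perm_F.mem_iff, List.mem_map]

theorem mem_L_iff : (∃ p ∈ S.L, p.1 = i) ↔ i ∈ S.I₁ ++ S.I₂ := by
  rw [← S.perm_L.mem_iff, List.mem_map]

theorem z_mem_front : z j ∈ S.front ↔ j ∈ S.J₁ ++ S.J₂ := by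
  simpa [front, eq_comm] using S.mem_F_iff (j := j)

theorem z_mem_back : z i ∈ S.back ↔ i ∈ S.I₁ ++ S.I₂ := by
  simpa [back, eq_comm] using S.mem_L_iff (i := i)

theorem y_not_mem_front : y S.h ∉ S.front := by
  simpa [front] using fun i hp => S.h_ne (i, S.h) (List.mem_append_left _ hp) rfl

theorem y_not_mem_back : y S.h ∉ S.back := by
  simpa [back] using fun i hp => S.h_ne (i, S.h) (List.mem_append_right _ hp) rfl

theorem z_mem_core : z i ∈ S.core ↔ i ∈ S.I ∨ i ∈ S.J := by
  simp only [core, I, J, List.mem_append, z_mem_front, z_mem_back, List.mem_cons, Letter.z.injEq,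
    reduceCtorEq, List.not_mem_nil, or_false, false_or]
  tauto

theorem t_not_mem_core : t i ∉ S.core := by
  simp [core, front, back]

theorem x_not_mem_core : x ∉ S.core := by
  simp [core, front, back]

theorem count_z_core : S.core.count (z i) = (S.I ++ S.J).count i := by
  have hF : S.front.count (z i) = (S.F.map Prod.fst).count i :=
    count_flatMap_eq_count_map (fun p => by simp [List.count_cons]) S.F
  have hL : S.back.count (z i) = (S.L.map Prod.fst).count i :=
    count_flatMap_eq_count_map (fun p => by simp [List.count_cons]) S.L
  simp only [core, I, J, List.append_assoc, List.cons_append, List.nil_append, List.count_append,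
    List.count_cons, hF, hL, S.perm_F.count_eq, S.perm_L.count_eq, beq_iff_eq, z.injEq,
    reduceCtorEq, if_false]
  omega

theorem count_z_pre : S.pre.count (z i) = S.I.count i :=
  (count_flatMap_eq_count_map (g := id) (d := i) (fun _ => by simp [List.count_cons]) S.I).trans
    (by rw [List.map_id])

theorem count_t_pre : S.pre.count (t i) = S.I.count i :=
  (count_flatMap_eq_count_map (g := id) (d := i) (fun _ => by simp [List.count_cons]) S.I).trans
    (by rw [List.map_id])

theorem count_z_suf : S.suf.count (z i) = S.J.count i :=
  (count_flatMap_eq_count_map (g := id) (d := i) (fun _ => by simp [List.count_cons]) S.J).trans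
    (by rw [List.map_id])

theorem count_t_suf : S.suf.count (t i) = S.J.count i :=
  (count_flatMap_eq_count_map (g := id) (d := i) (fun _ => by simp [List.count_cons]) S.J).trans
    (by rw [List.map_id])

theorem z_mem_pre : z i ∈ S.pre ↔ i ∈ S.I := by
  simp [pre]

theorem t_mem_pre : t i ∈ S.pre ↔ i ∈ S.I := by
  simp [pre]

theorem z_mem_suf : z i ∈ S.suf ↔ i ∈ S.J := by
  simp [suf]

theorem t_mem_suf : t i ∈ S.suf ↔ i ∈ S.J := by
  simp [suf]

theorem x_not_mem_pre : x ∉ S.pre := by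
  simp [pre]

theorem x_not_mem_suf : x ∉ S.suf := by
  simp [suf]

theorem y_not_mem_pre : y i ∉ S.pre := by
  simp [pre]

theorem y_not_mem_suf : y i ∉ S.suf := by
  simp [suf]

theorem count_y_core : S.core.count (y S.h) = 2 := by
  simp [core, List.count_eq_zero_of_not_mem y_not_mem_front,
    List.count_eq_zero_of_not_mem y_not_mem_back]

theorem count_z_word (hi : i ∈ S.I ++ S.J) : S.word.count (z i) = 2 := by
  have := List.count_eq_one_of_mem S.nodup_append hi
  simp only [word, List.count_append, count_z_pre, count_z_core, count_z_suf, ne_eq, reduceCtorEq,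
    not_false_eq_true, List.count_cons_of_ne, List.count_nil] at this ⊢
  omega

theorem count_t_word (hi : i ∈ S.I ++ S.J) : S.word.count (t i) = 1 := by
  have := List.count_eq_one_of_mem S.nodup_append hi
  simp only [word, List.count_append, count_t_pre, count_t_suf,
    List.count_eq_zero_of_not_mem t_not_mem_core, ne_eq, reduceCtorEq, not_false_eq_true,
    List.count_cons_of_ne, List.count_nil] at this ⊢
  omega

theorem count_x_word : S.word.count x = 2 := by
  simp [word, List.count_eq_zero_of_not_mem x_not_mem_core,
    List.count_eq_zero_of_not_mem x_not_mem_pre, List.count_eq_zero_of_not_mem x_not_mem_suf]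

theorem exists_eq_z_or_two_le_count_core {c : Letter} (hc : c ∈ S.core) :
    (∃ i, c = z i) ∨ 2 ≤ S.core.count c := by
  obtain hc | rfl | ⟨p, hp, rfl⟩ : (∃ i, c = z i) ∨ c = y S.h ∨ ∃ p ∈ S.F ++ S.L, c = y p.2 := by
    simp only [core, front, back, List.mem_append, List.mem_flatMap, List.mem_cons,
      List.not_mem_nil, or_false] at hc ⊢
    grind
  · exact Or.inl hc
  · exact Or.inr count_y_core.ge
  · right
    rw [core, List.count_append, List.count_append]
    rcases List.mem_append.1 hp with hp | hp
    · have h : 2 ≤ S.front.count (y p.2) :=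
        le_of_eq_of_le (by simp) (count_le_count_flatMap hp)
      omega
    · have h : 2 ≤ S.back.count (y p.2) :=
        le_of_eq_of_le (by simp) (count_le_count_flatMap hp)
      omega

theorem firstLT_z_t (hi : i ∈ S.I ++ S.J) : FirstLT S.word (z i) (t i) := by
  rcases List.mem_append.1 hi with hi | hi
  · obtain ⟨as, bs, hI, has⟩ := List.eq_append_cons_of_mem hi
    have hpre : S.pre = as.flatMap (fun i => [z i, t i]) ++ [z i] ++
        (t i :: bs.flatMap fun i => [z i, t i]) := by
      simp [pre, hI]
    have h : FirstLT S.pre (z i) (t i) :=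
      hpre ▸ firstLT_append_of_mem (by simp) (by simpa using has)
    simp only [word, List.append_assoc]
    exact h.append_right _
  · have hi' : i ∉ S.I := fun h => not_mem_J_of_mem_I h hi
    rw [word, List.append_assoc]
    exact firstLT_append_of_mem (by simp [z_mem_core, hi])
      (by simp [t_mem_pre, t_not_mem_core, hi'])

theorem lastLT_t_z (hi : i ∈ S.I ++ S.J) : LastLT S.word (t i) (z i) := by
  rw [← firstLT_reverse, ← rev_word]
  exact firstLT_z_t (by simpa [mem_rev_I, mem_rev_J, or_comm] using hi)

theorem firstLT_x_z (hj : j ∈ S.J) : FirstLT S.word x (z j) := by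
  simp only [word, List.append_assoc _ S.core]
  exact (firstLT_append_of_mem (by simp) (by
    simpa [z_mem_pre] using fun h => not_mem_J_of_mem_I h hj)).append_right _

theorem firstLT_z_y (hj : j ∈ S.J) : FirstLT S.word (z j) (y S.h) := by
  have h : S.word = (S.pre ++ [x] ++ S.front ++ [z S.κ]) ++
      ([y S.h, y S.h, z S.ζ] ++ S.back ++ [x] ++ S.suf) := by
    simp [word, core]
  rw [h]
  refine firstLT_append_of_mem ?_ (by simp [y_not_mem_front, y_not_mem_pre])
  have : j ∈ S.J₁ ++ S.J₂ ∨ j = S.κ := by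
    simp only [J, List.mem_append, List.mem_cons] at hj ⊢
    tauto
  simpa [z_mem_front, or_assoc] using Or.inr this

theorem firstLT_y_t (hj : j ∈ S.J) : FirstLT S.word (y S.h) (t j) := by
  have hI : j ∉ S.I := fun h => not_mem_J_of_mem_I h hj
  rw [word, List.append_assoc]
  exact firstLT_append_of_mem (by simp [core]) (by simp [t_mem_pre, t_not_mem_core, hI])

theorem lastLT_x_z (hj : j ∈ S.J) : LastLT S.word x (z j) :=
  lastLT_append_of_mem x_not_mem_suf (z_mem_suf.2 hj)

theorem lastLT_y_x : LastLT S.word (y S.h) x := by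
  rw [word, List.append_assoc]
  exact lastLT_append_of_mem (by simp [y_not_mem_suf]) (by simp)

theorem pairwise_lastLT_z_t : S.J.Pairwise fun i j => LastLT S.word (z i) (t j) := by
  have h (J : List ℕ) (hJ : J.Nodup) :
      J.Pairwise fun i j => LastLT (J.flatMap fun j => [t j, z j]) (z i) (t j) := by
    induction J with
    | nil => exact List.Pairwise.nil
    | cons i J ih =>
      obtain ⟨hi, hJ⟩ := List.nodup_cons.1 hJ
      refine List.pairwise_cons.2 ⟨fun j hj => ?_, (ih hJ).imp fun h => h.append_left _⟩
      exact lastLT_append_of_mem (by simpa using hi) (by simpa using hj)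
  exact (h S.J (List.nodup_append.1 S.nodup_append).2.1).imp fun h => h.append_left _

theorem rigid_t (hi : i ∈ S.I ++ S.J) : Rigid S.word (t i) :=
  .once (count_t_word hi)

theorem rigid_z (hi : i ∈ S.I ++ S.J) : Rigid S.word (z i) :=
  .twice (count_z_word hi) (rigid_t hi) (rigid_t hi).mem (firstLT_z_t hi) (lt_irrefl _)
    (lastLT_t_z hi)

theorem rigid_x : Rigid S.word x :=
  .twice count_x_word (rigid_z (List.mem_append_right _ S.κ_mem_J)) (by simp [word, core])
    (firstLT_x_z S.κ_mem_J) (firstLT_z_y S.κ_mem_J).not_firstLT lastLT_y_x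

end SplitWord

end SplitWords

section Probes

open FreeMonoid Letter

/-- A substitution `ψ` in a context. A word `w` whose class modulo `alphaOneAperiodic` is known
gives information on a word `u` through `left · ψ(u) · right ≈ w`. -/
structure Probe where
  left : List Letter
  ψ : Letter → List Letter
  right : List Letter

namespace Probe

variable {P : Probe} {u v w : List Letter} {c d c' d' : Letter}

/-- The value of the probe at a word. -/
def eval (P : Probe) (u : List Letter) : List Letter := P.left ++ u.flatMap P.ψ ++ P.right

/-- The value of the probe at `u` lies in the class of `w`. -/
def Holds (P : Probe) (w u : List Letter) : Prop := aperiodicClass (P.eval u) = aperiodicClass w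

/-- The occurrences of `c'` in a value of the probe come from those of `c` in the argument. -/
structure Tracks (P : Probe) (c c' : Letter) : Prop where
  mem_iff : ∀ e, c' ∈ P.ψ e ↔ e = c
  not_mem_left : c' ∉ P.left
  not_mem_right : c' ∉ P.right

theorem Holds.sameRigid (h : P.Holds w u) : SameRigid w (P.eval u) :=
  .of_alphaOneAperiodic (aperiodicClass_eq_iff.1 h.symm)

theorem Holds.count_eq (h : P.Holds w u) (hc : P.Tracks c c') (hr : Rigid w c')
    (hcount : (P.ψ c).count c' = 1) : u.count c = w.count c' := by
  rw [← h.sameRigid.count_eq hr, eval, List.count_append, List.count_append,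
    List.count_eq_zero_of_not_mem hc.not_mem_left, List.count_eq_zero_of_not_mem hc.not_mem_right,
    count_flatMap_eq_count_map (g := id) (d := c) fun e => ?_, List.map_id, zero_add, add_zero]
  by_cases he : e = c
  · simp [he, hcount]
  · simp [he, List.count_eq_zero_of_not_mem (mt (hc.mem_iff e).1 he)]

theorem Holds.firstLT_iff (h : P.Holds w u) (hc : P.Tracks c c') (hd : P.Tracks d d')
    (hcd : c ≠ d) (hr : Rigid w c' ∨ Rigid w d') : FirstLT u c d ↔ FirstLT w c' d' := by
  have hw : FirstLT (P.eval u) c' d' ↔ FirstLT w c' d' :=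
    hr.elim (h.sameRigid.firstLT_iff · d') (h.sameRigid.firstLT_iff' · c')
  rw [← hw, eval, ← firstLT_flatMap hcd hc.mem_iff hd.mem_iff, firstLT_append, firstLT_append]
  have hl : ¬ FirstLT P.left c' d' := fun h => hc.not_mem_left h.mem
  have hr : ¬ FirstLT P.right c' d' := fun h => hc.not_mem_right h.mem
  simp [hl, hr, hc.not_mem_left, hd.not_mem_left]

theorem Holds.lastLT_iff (h : P.Holds w u) (hc : P.Tracks c c') (hd : P.Tracks d d')
    (hcd : c ≠ d) (hr : Rigid w c' ∨ Rigid w d') : LastLT u c d ↔ LastLT w c' d' := by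
  have hw : LastLT (P.eval u) c' d' ↔ LastLT w c' d' :=
    hr.elim (h.sameRigid.lastLT_iff · d') (h.sameRigid.lastLT_iff' · c')
  rw [← hw, eval, ← lastLT_flatMap hcd hc.mem_iff hd.mem_iff, lastLT_append, lastLT_append]
  have hl : ¬ LastLT P.left c' d' := fun h => hd.not_mem_left h.mem
  have hr : ¬ LastLT P.right c' d' := fun h => hd.not_mem_right h.mem
  simp [hl, hr, hc.not_mem_right, hd.not_mem_right]

theorem Holds.of_fic {w u v : Word} (huv : (sapirVariety alphaOneAperiodic {↑w}).fic u v)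
    (h : P.Holds (toList w) (toList u)) : P.Holds (toList w) (toList v) := by
  have heval (u : Word) : ofList (P.eval (toList u)) =
      ofList P.left * lift (ofList ∘ P.ψ) u * ofList P.right := by
    rw [← ofList_toList (lift (ofList ∘ P.ψ) u), toList_lift]
    rfl
  rw [Holds, aperiodicClass_eq_iff, heval, ofList_toList] at h ⊢
  exact sapirVariety_context huv h

/-- The reversed substitution in the reversed context. -/
def reverse (P : Probe) : Probe where
  left := P.right.reverse
  ψ c := (P.ψ c).reverse
  right := P.left.reverse

theorem holds_reverse_reverse : P.Holds w.reverse u.reverse ↔ P.reverse.Holds w u := by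
  have heval : P.reverse.eval u = (P.eval u.reverse).reverse := by
    simp [eval, reverse, List.reverse_flatMap, Function.comp_def]
  rw [Holds, Holds, heval]
  exact ⟨fun h => by simpa using aperiodicClass_reverse h,
    fun h => by simpa using aperiodicClass_reverse h⟩

theorem holds_square (h : ∀ c ∈ v, ∃ a, P.ψ c = a ++ a) (l r : List Letter) :
    P.Holds w (l ++ (v ++ v) ++ r) ↔ P.Holds w (l ++ v ++ r) := by
  have hv : aperiodicClass ((v ++ v).flatMap P.ψ) = aperiodicClass (v.flatMap P.ψ) := by
    rw [List.flatMap_append]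
    exact isIdempotentElem_aperiodicClass_flatMap h
  simp only [Holds, eval, List.flatMap_append, aperiodicClass_append] at hv ⊢
  rw [hv]

end Probe

theorem flatMap_eq_flatten_replicate {α β : Type*} [DecidableEq α] {f : α → List β} {u : List α}
    {d : α} (h : ∀ c ∈ u, c ≠ d → f c = []) :
    u.flatMap f = (List.replicate (u.count d) (f d)).flatten := by
  induction u with
  | nil => rfl
  | cons c u ih =>
    rw [List.flatMap_cons, ih fun b hb => h b (List.mem_cons_of_mem c hb)]
    by_cases hc : c = d
    · rw [hc, List.count_cons_self, List.replicate_succ, List.flatten_cons]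
    · rw [h c List.mem_cons_self hc, List.count_cons_of_ne hc, List.nil_append]

theorem flatMap_eq_of_lastLT {α β : Type*} [DecidableEq α] {f : α → List β} {u : List α} {h e : α}
    (hf : ∀ c ∈ u, c ≠ h → c ≠ e → f c = []) (hh : u.count h = 2) (he : u.count e = 1)
    (hhe : LastLT u h e) : u.flatMap f = f h ++ f h ++ f e := by
  obtain ⟨A, B, rfl, heA⟩ := List.eq_append_cons_of_mem hhe.mem
  have heB : e ∉ B := List.count_eq_zero.1 (by
    simp only [List.count_append, List.count_cons_self] at he
    omega)
  have hhB : h ∉ B := by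
    rw [← List.singleton_append, ← List.append_assoc] at hhe
    exact hhe.not_mem_of_not_mem heB
  have hcountA : A.count h = 2 := by
    simpa [List.count_cons, hhe.ne.symm, List.count_eq_zero_of_not_mem hhB] using hh
  have hfA : A.flatMap f = f h ++ f h := by
    rw [flatMap_eq_flatten_replicate fun c hc hch => hf c (List.mem_append_left _ hc) hch
      (ne_of_mem_of_not_mem hc heA), hcountA]
    simp [List.replicate]
  have hfB : B.flatMap f = [] := List.flatMap_eq_nil_iff.2 fun c hc =>
    hf c (by simp [hc]) (ne_of_mem_of_not_mem hc hhB) (ne_of_mem_of_not_mem hc heB)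
  rw [List.flatMap_append, List.flatMap_cons, hfA, hfB, List.append_nil]

theorem flatMap_eq_of_firstLT_of_lastLT {α β : Type*} [DecidableEq α] {f : α → List β} {u : List α}
    {g h e : α} (hf : ∀ c ∈ u, c ≠ g → c ≠ h → c ≠ e → f c = []) (hg : u.count g = 2)
    (hh : u.count h = 2) (he : u.count e = 1) (hgh : FirstLT u g h) (hge : FirstLT u g e)
    (hhe : LastLT u h e) (heg : LastLT u e g) :
    u.flatMap f = f g ++ (f h ++ f h ++ f e) ++ f g := by
  obtain ⟨A, D, rfl, hgA⟩ := List.eq_append_cons_of_mem hgh.mem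
  have hgD : D.count g = 1 := by
    simpa [List.count_eq_zero_of_not_mem hgA] using hg
  obtain ⟨B, C, rfl, hgB⟩ := List.eq_append_cons_of_mem (List.count_pos_iff.1 (hgD.ge : 0 < _))
  have hgC : g ∉ C := List.count_eq_zero.1 (by
    simp only [List.count_append, List.count_cons_self] at hgD
    omega)
  have hhA := hgh.not_mem_of_not_mem hgA
  have heA := hge.not_mem_of_not_mem hgA
  have hsplit : A ++ g :: (B ++ g :: C) = A ++ [g] ++ B ++ [g] ++ C := by simp
  rw [hsplit] at hf hh he hhe heg ⊢
  have heC := heg.not_mem_of_not_mem hgC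
  have hhC := hhe.not_mem_of_not_mem heC
  have hB : B.flatMap f = f h ++ f h ++ f e := by
    refine flatMap_eq_of_lastLT (fun c hc => hf c (by simp [hc]) (ne_of_mem_of_not_mem hc hgB))
      ?_ ?_ ?_
    · simpa [List.count_eq_zero_of_not_mem, hhA, hhC, hgh.ne] using hh
    · simpa [List.count_eq_zero_of_not_mem, heA, heC, hge.ne] using he
    · rcases lastLT_append.1 ((hhe.of_append heC).of_append (by simpa using hge.ne.symm)) with h | h
      · exact h
      · exact absurd h.2.2.mem (by simp [heA, hge.ne.symm])
  have hfA : A.flatMap f = [] := List.flatMap_eq_nil_iff.2 fun c hc => hf c (by simp [hc])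
    (ne_of_mem_of_not_mem hc hgA) (ne_of_mem_of_not_mem hc hhA) (ne_of_mem_of_not_mem hc heA)
  have hfC : C.flatMap f = [] := List.flatMap_eq_nil_iff.2 fun c hc => hf c (by simp [hc])
    (ne_of_mem_of_not_mem hc hgC) (ne_of_mem_of_not_mem hc hhC) (ne_of_mem_of_not_mem hc heC)
  simp [hfA, hfC, hB]

namespace SplitWord

variable {S : SplitWord} {u : List Letter} {g h e : Letter}

/-- The factor of the word before the first occurrence of `z_κ`. -/
def before (S : SplitWord) : List Letter := S.pre ++ [.x] ++ S.front

/-- The factor of the word between the last occurrence of `y_h` and the second one of `z_κ`. -/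
def between (S : SplitWord) : List Letter :=
  [.z S.ζ] ++ S.back ++ [.x] ++ S.J₁.flatMap (fun j => [.t j, .z j]) ++ [.t S.κ]

/-- The factor of the word behind the second occurrence of `z_κ`. -/
def after (S : SplitWord) : List Letter := S.J₂.flatMap fun j => [.t j, .z j]

theorem word_eq : S.word =
    S.before ++ [.z S.κ] ++ [.y S.h, .y S.h] ++ S.between ++ [.z S.κ] ++ S.after := by
  simp [word, core, before, between, after, suf, J]

/-- Maps `g h h e g` to the word, through `g ↦ z_κ` and `h ↦ y_h²`. -/
def sqProbe (S : SplitWord) (g h e : Letter) : Probe where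
  left := S.before
  ψ c := if c = g then [.z S.κ] else if c = h then [.y S.h, .y S.h] else
    if c = e then S.between else []
  right := S.after

/-- Maps `h h e` to the word, through `h ↦ y_h²`. -/
def tailProbe (S : SplitWord) (h e : Letter) : Probe where
  left := S.before ++ [.z S.κ]
  ψ c := if c = h then [.y S.h, .y S.h] else
    if c = e then S.between ++ [.z S.κ] ++ S.after else []
  right := []

/-- Maps `a` to `x`, doubles the letters between the two occurrences of `x`, fixes the other letters
of the word and deletes all letters that do not occur in it. -/
def wordProbe (S : SplitWord) (a : Letter) : Probe where
  left := []
  ψ c := if c = a then [.x] else if c ∈ S.pre ++ S.suf then [c] else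
    if c ∈ S.core then [c, c] else []
  right := []

theorem aperiodicClass_square_square (l r : List Letter) (c : Letter) :
    aperiodicClass (l ++ [c, c, c, c] ++ r) = aperiodicClass (l ++ [c, c] ++ r) := by
  have h : aperiodicClass [c, c, c, c] = aperiodicClass [c, c] :=
    isIdempotentElem_aperiodicClass_flatMap (u := [c]) (ψ := fun c => [c, c]) fun c _ => ⟨[c], rfl⟩
  rw [aperiodicClass_append, aperiodicClass_append, h]
  rfl

theorem tailProbe_holds (hh : u.count h = 2) (he : u.count e = 1) (hhe : LastLT u h e) :
    (S.tailProbe h e).Holds S.word u := by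
  have hψ : u.flatMap (S.tailProbe h e).ψ = [.y S.h, .y S.h] ++ [.y S.h, .y S.h] ++
      (S.between ++ [.z S.κ] ++ S.after) := by
    rw [flatMap_eq_of_lastLT (fun c _ hch hce => by simp [tailProbe, hch, hce]) hh he hhe]
    simp [tailProbe, hhe.ne.symm]
  rw [Probe.Holds, Probe.eval, hψ, word_eq]
  have hy := aperiodicClass_square_square (S.before ++ [.z S.κ])
    (S.between ++ [.z S.κ] ++ S.after) (.y S.h)
  simpa [tailProbe] using hy

theorem sqProbe_holds (hg : u.count g = 2) (hh : u.count h = 2) (he : u.count e = 1)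
    (hgh : FirstLT u g h) (hge : FirstLT u g e) (hhe : LastLT u h e) (heg : LastLT u e g) :
    (S.sqProbe g h e).Holds S.word u := by
  have hψ : u.flatMap (S.sqProbe g h e).ψ = [.z S.κ] ++ ([.y S.h, .y S.h] ++ [.y S.h, .y S.h] ++
      S.between) ++ [.z S.κ] := by
    rw [flatMap_eq_of_firstLT_of_lastLT (fun c _ hcg hch hce => by simp [sqProbe, hcg, hch, hce])
      hg hh he hgh hge hhe heg]
    simp [sqProbe, hhe.ne.symm, hgh.ne.symm, hge.ne.symm]
  rw [Probe.Holds, Probe.eval, hψ, word_eq]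
  have hy := aperiodicClass_square_square (S.before ++ [.z S.κ])
    (S.between ++ [.z S.κ] ++ S.after) (.y S.h)
  simpa [sqProbe] using hy

theorem not_mem_before :
    z S.κ ∉ S.before ∧ y S.h ∉ S.before ∧ t S.κ ∉ S.before := by
  refine ⟨?_, ?_, ?_⟩
  · simp [before, z_mem_pre, z_mem_front, S.κ_not_mem_I, S.κ_not_mem_J₁_append_J₂]
  · simp [before, y_not_mem_pre, y_not_mem_front]
  · simp [before, t_mem_pre, S.κ_not_mem_I, front]

theorem not_mem_between : z S.κ ∉ S.between ∧ y S.h ∉ S.between := by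
  have hI := S.κ_not_mem_I
  have hJ := S.κ_not_mem_J₁_append_J₂
  simp only [I, List.mem_append, List.mem_cons, not_or] at hI hJ
  exact ⟨by simp [between, z_mem_back, hI, hJ], by simp [between, y_not_mem_back]⟩

theorem t_mem_between : t S.κ ∈ S.between := by
  simp [between]

theorem count_t_between : S.between.count (t S.κ) = 1 := by
  have hκ : S.κ ∉ S.J₁ := fun h => S.κ_not_mem_J₁_append_J₂ (List.mem_append_left _ h)
  have hcount : ((S.J₁.flatMap fun j => [t j, z j]).count (t S.κ)) = 0 := by
    simp [List.count_eq_zero, hκ]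
  have hback : t S.κ ∉ S.back := by simp [back]
  simp [between, hcount, List.count_eq_zero_of_not_mem hback]

theorem not_mem_after :
    z S.κ ∉ S.after ∧ y S.h ∉ S.after ∧ t S.κ ∉ S.after := by
  have hκ : S.κ ∉ S.J₂ := fun h => S.κ_not_mem_J₁_append_J₂ (List.mem_append_right _ h)
  simp [after, hκ]

theorem tailProbe_tracks_y : (S.tailProbe h e).Tracks h (y S.h) where
  mem_iff c := by
    simp only [tailProbe]
    grind [S.not_mem_between, S.not_mem_after]
  not_mem_left := by simp [tailProbe, not_mem_before]
  not_mem_right := by simp [tailProbe]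

theorem tailProbe_tracks_t (hhe : h ≠ e) : (S.tailProbe h e).Tracks e (t S.κ) where
  mem_iff c := by
    simp only [tailProbe]
    grind [S.t_mem_between]
  not_mem_left := by simp [tailProbe, not_mem_before]
  not_mem_right := by simp [tailProbe]

theorem sqProbe_tracks_z : (S.sqProbe g h e).Tracks g (z S.κ) where
  mem_iff c := by
    simp only [sqProbe]
    grind [S.not_mem_between]
  not_mem_left := not_mem_before.1
  not_mem_right := not_mem_after.1

theorem sqProbe_tracks_y (hgh : g ≠ h) : (S.sqProbe g h e).Tracks h (y S.h) where
  mem_iff c := by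
    simp only [sqProbe]
    grind [S.not_mem_between]
  not_mem_left := not_mem_before.2.1
  not_mem_right := not_mem_after.2.1

theorem sqProbe_tracks_t (hge : g ≠ e) (hhe : h ≠ e) : (S.sqProbe g h e).Tracks e (t S.κ) where
  mem_iff c := by
    simp only [sqProbe]
    grind [S.t_mem_between]
  not_mem_left := not_mem_before.2.2
  not_mem_right := not_mem_after.2.2

theorem wordProbe_tracks_x {a : Letter} : (S.wordProbe a).Tracks a x where
  mem_iff c := by
    simp only [wordProbe]
    split_ifs with ha hc hc
    · simp [ha]
    · simpa [ha] using (ne_of_mem_of_not_mem hc (by simp [x_not_mem_pre, x_not_mem_suf])).symm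
    · simpa [ha] using (ne_of_mem_of_not_mem hc x_not_mem_core).symm
    · simp [ha]
  not_mem_left := List.not_mem_nil
  not_mem_right := List.not_mem_nil

theorem wordProbe_tracks_self {a c : Letter} (hc : c ∈ S.pre ++ S.suf ∨ c ∈ S.core) (hca : c ≠ a) :
    (S.wordProbe a).Tracks c c where
  mem_iff e := by
    have hcx : c ≠ x := by
      rintro rfl
      simp [x_not_mem_pre, x_not_mem_suf, x_not_mem_core] at hc
    simp only [wordProbe]
    grind
  not_mem_left := List.not_mem_nil
  not_mem_right := List.not_mem_nil

theorem wordProbe_flatMap_of_subset {a : Letter} {v : List Letter} (hv : v ⊆ S.pre ++ S.suf)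
    (ha : a ∉ v) : v.flatMap (S.wordProbe a).ψ = v :=
  calc v.flatMap (S.wordProbe a).ψ = v.flatMap fun c => [c] :=
        List.flatMap_congr fun _ hc =>
          (if_neg (ne_of_mem_of_not_mem hc ha)).trans (if_pos (hv hc))
    _ = v := List.flatMap_singleton' v

theorem aperiodicClass_wordProbe_core {a : Letter} (ha : a ∉ S.core) :
    aperiodicClass (S.core.flatMap (S.wordProbe a).ψ) = aperiodicClass S.core := by
  have hz {i : ℕ} (hi : z i ∈ S.core) : (S.wordProbe a).ψ (z i) = [z i] :=
    (if_neg (ne_of_mem_of_not_mem hi ha)).trans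
      (if_pos (by simpa [z_mem_pre, z_mem_suf, z_mem_core] using hi))
  have hy {m : ℕ} (hm : y m ∈ S.core) : (S.wordProbe a).ψ (y m) = [y m, y m] :=
    (if_neg (ne_of_mem_of_not_mem hm ha)).trans
      ((if_neg (by simp [y_not_mem_pre, y_not_mem_suf])).trans (if_pos hm))
  have hfront : aperiodicClass (S.front.flatMap (S.wordProbe a).ψ) = aperiodicClass S.front := by
    rw [front, List.flatMap_assoc]
    refine aperiodicClass_flatMap_congr fun p hp => ?_
    have hzp : z p.1 ∈ S.core :=
      List.mem_append_left _ (List.mem_append_left _ (List.mem_flatMap.2 ⟨p, hp, by simp⟩))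
    have hyp : y p.2 ∈ S.core :=
      List.mem_append_left _ (List.mem_append_left _ (List.mem_flatMap.2 ⟨p, hp, by simp⟩))
    simpa [hz hzp, hy hyp] using aperiodicClass_square_square [z p.1] [] (y p.2)
  have hback : aperiodicClass (S.back.flatMap (S.wordProbe a).ψ) = aperiodicClass S.back := by
    rw [back, List.flatMap_assoc]
    refine aperiodicClass_flatMap_congr fun p hp => ?_
    have hzp : z p.1 ∈ S.core :=
      List.mem_append_right _ (List.mem_flatMap.2 ⟨p, hp, by simp⟩)
    have hyp : y p.2 ∈ S.core :=
      List.mem_append_right _ (List.mem_flatMap.2 ⟨p, hp, by simp⟩)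
    simpa [hz hzp, hy hyp] using aperiodicClass_square_square [] [z p.1] (y p.2)
  have hmid : aperiodicClass ([z S.κ, y S.h, y S.h, z S.ζ].flatMap (S.wordProbe a).ψ) =
      aperiodicClass [z S.κ, y S.h, y S.h, z S.ζ] := by
    have hκ : z S.κ ∈ S.core := by simp [core]
    have hh : y S.h ∈ S.core := by simp [core]
    have hζ : z S.ζ ∈ S.core := by simp [core]
    simpa [hz hκ, hy hh, hz hζ] using aperiodicClass_square_square [z S.κ] [z S.ζ] (y S.h)
  simp only [core, List.flatMap_append, aperiodicClass_append] at hfront hback hmid ⊢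
  rw [hfront, hmid, hback]

theorem lastLT_y_t {j : ℕ} (hj : j ∈ S.J) : LastLT S.word (y S.h) (t j) :=
  lastLT_append_of_mem y_not_mem_suf (t_mem_suf.2 hj)

theorem lastLT_of_tailProbe_holds (hhe : h ≠ e) (H : (S.tailProbe h e).Holds S.word u) :
    LastLT u h e :=
  (H.lastLT_iff tailProbe_tracks_y (tailProbe_tracks_t hhe) hhe
    (Or.inr (rigid_t (List.mem_append_right _ S.κ_mem_J)))).2 (lastLT_y_t S.κ_mem_J)

theorem orders_of_sqProbe_holds (hgh : g ≠ h) (hge : g ≠ e) (hhe : h ≠ e)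
    (H : (S.sqProbe g h e).Holds S.word u) :
    (u.count g = 2 ∧ u.count e = 1) ∧ (FirstLT u g h ∧ FirstLT u g e) ∧
      LastLT u h e ∧ LastLT u e g := by
  have hκ : S.κ ∈ S.I ++ S.J := List.mem_append_right _ S.κ_mem_J
  have hg : (S.sqProbe g h e).Tracks g (z S.κ) := sqProbe_tracks_z
  have hh := sqProbe_tracks_y (S := S) (e := e) hgh
  have he := sqProbe_tracks_t (S := S) hge hhe
  have hz := rigid_z hκ
  have ht := rigid_t hκ
  refine ⟨⟨?_, ?_⟩, ⟨?_, ?_⟩, ?_, ?_⟩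
  · exact (H.count_eq hg hz (by simp [sqProbe])).trans (count_z_word hκ)
  · refine (H.count_eq he ht ?_).trans (count_t_word hκ)
    simp [sqProbe, hge.symm, hhe.symm, count_t_between]
  · exact (H.firstLT_iff hg hh hgh (.inl hz)).2 (firstLT_z_y S.κ_mem_J)
  · exact (H.firstLT_iff hg he hge (.inl hz)).2 (firstLT_z_t hκ)
  · exact (H.lastLT_iff hh he hhe (.inr ht)).2 (lastLT_y_t S.κ_mem_J)
  · exact (H.lastLT_iff he hg hge.symm (.inl ht)).2 (lastLT_t_z hκ)

end SplitWord

end Probes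

section RepeatedBlocks

variable {α β : Type*} {l r : List α} {θ : β → List α}
  {A A₁ A₂ A₃ B : List β} {H : List α} {a b : β} {c d d' e η : α}

/-- The word `l · θ(A₁ b A₂ b A₃) · r`. -/
def blockWord (θ : β → List α) (l : List α) (A₁ : List β) (b : β) (A₂ A₃ : List β) (r : List α) :
    List α :=
  (l ++ A₁.flatMap θ) ++ θ b ++ A₂.flatMap θ ++ θ b ++ (A₃.flatMap θ ++ r)

theorem blockWord_eq :
    blockWord θ l A₁ b A₂ A₃ r = l ++ (A₁ ++ [b] ++ A₂ ++ [b] ++ A₃).flatMap θ ++ r := by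
  simp [blockWord]

variable [DecidableEq α]

theorem two_le_count_flatMap [DecidableEq β] (ha : 2 ≤ A.count a) (hc : c ∈ θ a) :
    2 ≤ (A.flatMap θ).count c :=
  calc 2 = 2 * 1 := rfl
    _ ≤ A.count a * (θ a).count c := Nat.mul_le_mul ha (List.count_pos_iff.2 hc)
    _ ≤ (A.flatMap θ).count c := count_mul_count_le_count_flatMap

/-- The letter `c` occurs exactly once in `u`, or it occurs twice and surrounds a letter that occurs
exactly once. -/
def Anchored (u : List α) (c : α) : Prop :=
  u.count c = 1 ∨ u.count c = 2 ∧ ∃ e, u.count e = 1 ∧ FirstLT u c e ∧ LastLT u e c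

/-- Some letter occurring exactly once in `u` lies between the last occurrences of `c` and `d`. -/
def Separated (u : List α) (c d : α) : Prop :=
  ∃ e, u.count e = 1 ∧ LastLT u c e ∧ LastLT u e d

theorem count_ne_one_of_mem_middle [DecidableEq β]
    (hA₂ : ∀ a ∈ A₂, 2 ≤ (A₁ ++ [b] ++ A₂ ++ [b] ++ A₃).count a)
    (he : e ∈ A₂.flatMap θ) : (blockWord θ l A₁ b A₂ A₃ r).count e ≠ 1 := by
  obtain ⟨a, ha, hea⟩ := List.mem_flatMap.1 he
  have := two_le_count_flatMap (hA₂ a ha) hea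
  rw [blockWord_eq, List.count_append, List.count_append]
  omega

theorem count_ne_one_of_mem_block (he : e ∈ θ b) :
    (blockWord θ l A₁ b A₂ A₃ r).count e ≠ 1 := by
  have := List.count_pos_iff.2 he
  simp only [blockWord, List.count_append]
  omega

theorem Anchored.not_mem_block [DecidableEq β] (h : Anchored (blockWord θ l A₁ b A₂ A₃ r) c)
    (hA₂ : ∀ a ∈ A₂, 2 ≤ (A₁ ++ [b] ++ A₂ ++ [b] ++ A₃).count a) : c ∉ θ b := by
  intro hc
  rcases h with h | ⟨h, e, he, hce, hec⟩
  · exact count_ne_one_of_mem_block hc h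
  · rcases (mem_left_or_mem_middle_of_surrounds hc h (List.count_pos_iff.1 (he.ge : 0 < _)) hce
      (lt_irrefl _) hec).2 with h | h
    · exact count_ne_one_of_mem_block h he
    · exact count_ne_one_of_mem_middle hA₂ h he

theorem Separated.not_mem_block (h : Separated (blockWord θ l A₁ b A₂ A₃ r) d d')
    (hd : (blockWord θ l A₁ b A₂ A₃ r).count d = 2)
    (hd' : (blockWord θ l A₁ b A₂ A₃ r).count d' = 2) (ha₂ : a ∈ A₂) (ha₃ : a ∈ A₃)
    (hda : d ∈ θ a) : d' ∉ θ a := by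
  intro hda'
  obtain ⟨e, he, hde, hed'⟩ := h
  obtain ⟨B₁, B₂, rfl⟩ := List.append_of_mem ha₃
  obtain ⟨s, q, hs, hsplit⟩ : ∃ s q, (∀ c ∈ θ a, 1 ≤ s.count c) ∧
      blockWord θ l A₁ b A₂ (B₁ ++ a :: B₂) r = s ++ (θ a ++ q) := by
    refine ⟨l ++ A₁.flatMap θ ++ θ b ++ A₂.flatMap θ ++ θ b ++ B₁.flatMap θ, B₂.flatMap θ ++ r,
      fun c hc => List.count_pos_iff.2 ?_, by simp [blockWord]⟩
    have : c ∈ A₂.flatMap θ := List.mem_flatMap.2 ⟨a, ha₂, hc⟩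
    simp [this]
  rw [hsplit] at hd hd' he hde hed'
  have not_mem_right {c : α} (hc : c ∈ θ a) (hcount : (s ++ (θ a ++ q)).count c ≤ 2) : c ∉ q := by
    have := hs c hc
    have := List.count_pos_iff.2 hc
    simp only [List.count_append] at hcount
    exact List.count_eq_zero.1 (by omega)
  have heq : e ∉ q := by
    rw [← List.append_assoc] at hed'
    exact hed'.not_mem_of_not_mem (not_mem_right hda' hd'.le)
  have hea : e ∈ θ a := by
    by_contra hea
    exact hde.not_mem_of_not_mem (by simp [hea, heq]) (List.mem_append_left _ hda)
  have := hs e hea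
  have := List.count_pos_iff.2 hea
  simp only [List.count_append] at he
  omega

variable [DecidableEq β]

theorem two_le_count_of_mem_middle
    (hA₂ : ∀ a ∈ A₂, a ∈ A₁ ∨ 2 ≤ A₂.count a ∨ a ∈ B ∧ a ∈ A₃) (ha : a ∈ A₂) :
    2 ≤ (A₁ ++ [b] ++ A₂ ++ [b] ++ A₃).count a := by
  have := List.count_pos_iff.2 ha
  simp only [List.count_append]
  rcases hA₂ a ha with h | h | h
  · have := List.count_pos_iff.2 h
    omega
  · omega
  · have := List.count_pos_iff.2 h.2
    omega

theorem exists_mem_of_surrounds (hA₂ : ∀ a ∈ A₂, a ∈ A₁ ∨ 2 ≤ A₂.count a ∨ a ∈ B ∧ a ∈ A₃)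
    (hcb : c ∈ θ b) (hdb : d ∉ θ b) (hc : (blockWord θ l A₁ b A₂ A₃ r).count c = 2)
    (hd : (blockWord θ l A₁ b A₂ A₃ r).count d = 2)
    (hη : η ∈ blockWord θ l A₁ b A₂ A₃ r) (hcd : FirstLT (blockWord θ l A₁ b A₂ A₃ r) c d)
    (hdη : FirstLT (blockWord θ l A₁ b A₂ A₃ r) d η)
    (hηc : LastLT (blockWord θ l A₁ b A₂ A₃ r) η c)
    (hcd' : LastLT (blockWord θ l A₁ b A₂ A₃ r) c d) :
    ∃ a ∈ B, (a ∈ A₂ ∧ a ∈ A₃) ∧ d ∈ θ a := by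
  obtain ⟨hdl, hdM⟩ := mem_left_or_mem_middle_of_surrounds hcb hc hη hcd hdη.not_firstLT hηc
  replace hdM := hdM.resolve_left hdb
  obtain ⟨a, ha, hda⟩ := List.mem_flatMap.1 hdM
  rcases hA₂ a ha with ha₁ | ha₂ | ⟨haB, ha₃⟩
  · exact absurd (List.mem_append_right _ (List.mem_flatMap.2 ⟨a, ha₁, hda⟩)) hdl
  · have := two_le_count_flatMap ha₂ hda
    have hdr : d ∉ θ b ++ (A₃.flatMap θ ++ r) := List.count_eq_zero.1 (by
      simp only [blockWord, List.count_append] at hd ⊢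
      omega)
    rw [blockWord, List.append_assoc _ (θ b)] at hcd'
    exact absurd (List.mem_append_left _ hcb) (hcd'.not_mem_of_not_mem hdr)
  · exact ⟨a, haB, ⟨ha, ha₃⟩, hda⟩

-- The letters of `H` lie in pairwise distinct blocks `θ a` with `a ∈ B`, so there are at most
-- `B.length` of them.
theorem not_mem_block_of_pairwise_separated
    (hA₂ : ∀ a ∈ A₂, a ∈ A₁ ∨ 2 ≤ A₂.count a ∨ a ∈ B ∧ a ∈ A₃) (hBH : B.length < H.length)
    (hsep : H.Pairwise (Separated (blockWord θ l A₁ b A₂ A₃ r))) (hHb : ∀ d ∈ H, d ∉ θ b)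
    (hH : ∀ d ∈ H, (blockWord θ l A₁ b A₂ A₃ r).count d = 2 ∧
      FirstLT (blockWord θ l A₁ b A₂ A₃ r) c d ∧ FirstLT (blockWord θ l A₁ b A₂ A₃ r) d η ∧
      LastLT (blockWord θ l A₁ b A₂ A₃ r) c d)
    (hc : (blockWord θ l A₁ b A₂ A₃ r).count c = 2) (hη : η ∈ blockWord θ l A₁ b A₂ A₃ r)
    (hηc : LastLT (blockWord θ l A₁ b A₂ A₃ r) η c) : c ∉ θ b := by
  intro hcb
  have : Nonempty β := ⟨b⟩
  choose! f hfB hf hfd using fun d hd => exists_mem_of_surrounds hA₂ hcb (hHb d hd) hc (hH d hd).1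
    hη (hH d hd).2.1 (hH d hd).2.2.1 hηc (hH d hd).2.2.2
  have hnodup : (H.map f).Nodup := by
    refine List.pairwise_map.2 (hsep.imp_of_mem fun {d d'} hd hd' h hdd' => ?_)
    exact h.not_mem_block (hH d hd).1 (hH d' hd').1 (hf d hd).1 (hf d hd).2 (hfd d hd)
      (hdd' ▸ hfd d' hd')
  have hle := (List.subperm_of_subset hnodup (l₂ := B) fun a ha => by
    obtain ⟨d, hd, rfl⟩ := List.mem_map.1 ha
    exact hfB d hd).length_le
  rw [List.length_map] at hle
  omega

end RepeatedBlocks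

section Frames

open FreeMonoid Letter

/-- A split word together with six letters that do not occur in it, and from which the words `gen`
separating the subvarieties are built. -/
structure Frame extends SplitWord where
  ξ : Letter
  ξ' : Letter
  μ : Letter
  μ' : Letter
  ν : Letter
  ν' : Letter
  nodup_fresh : [ξ, ξ', μ, μ', ν, ν'].Nodup
  fresh : ∀ c ∈ [ξ, ξ', μ, μ', ν, ν'], c ∉ toSplitWord.pre ++ toSplitWord.core ++ toSplitWord.suf

namespace Frame

/-- The frame of the reversed word. -/
def rev (F : Frame) : Frame where
  toSplitWord := F.toSplitWord.rev
  ξ := F.ξ'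
  ξ' := F.ξ
  μ := F.ν
  μ' := F.ν'
  ν := F.μ
  ν' := F.μ'
  nodup_fresh := by
    have h := F.nodup_fresh
    simp only [List.nodup_cons, List.mem_cons, List.not_mem_nil, or_false, not_or] at h ⊢
    grind
  fresh c hc := by
    have h := F.fresh c (by simp only [List.mem_cons] at hc ⊢; tauto)
    simp only [SplitWord.rev_pre, SplitWord.rev_core, SplitWord.rev_suf, List.mem_append,
      List.mem_reverse] at h ⊢
    tauto

variable (F : Frame)

/-- The words occurring in the separating identities, where `X` and `X'` are words over `ξ` and
`ξ'`. -/
def gen (X X' : List Letter) : List Letter :=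
  F.pre ++ [F.μ, F.μ'] ++ X ++ [F.ν] ++ X' ++ F.core ++ X ++ [F.μ] ++ X' ++ [F.ν', F.ν] ++ F.suf

theorem reverse_gen (X X' : List Letter) :
    (F.gen X X').reverse = F.rev.gen X'.reverse X.reverse := by
  simp [gen, rev, SplitWord.rev_pre, SplitWord.rev_core, SplitWord.rev_suf]

/-- The letters whose images under a substitution into a word of `F.Left` determine whether the
word stays in `F.Left` when an image is doubled. -/
def fixed : List Letter := F.ξ :: F.ν :: F.ν' :: (F.pre ++ F.suf)

/-- The words that share with `F.gen [ξ] [ξ']` all those properties detected by probes which cannot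
tell a letter outside `F.fixed` from its square, and in which the first occurrence of `ξ` precedes
that of `ν`. The latter is phrased as the failure of a probe, so that it only depends on the word
modulo the identities of `M(word)`. -/
def Left (U : List Letter) : Prop :=
  (∀ P : Probe, (∀ c ∉ F.fixed, ∃ a, P.ψ c = a ++ a) →
    P.Holds F.word (F.gen [F.ξ] [F.ξ']) → P.Holds F.word U) ∧
  ¬ (F.sqProbe F.ν F.ξ F.ν').Holds F.word U

variable {F} {U V : List Letter} {c : Letter} {h i j : ℕ}

theorem Left.congr (h : ∀ P : Probe, P.Holds F.word U ↔ P.Holds F.word V) (hU : F.Left U) :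
    F.Left V :=
  ⟨fun P hP hgen => (h P).1 (hU.1 P hP hgen), fun hV => hU.2 ((h _).2 hV)⟩

theorem Left.double_iff {W : List Letter} (hW : ∀ c ∈ F.fixed, c ∉ W) (p M q : List Letter) :
    F.Left (p ++ W ++ M ++ W ++ q) ↔ F.Left (p ++ (W ++ W) ++ M ++ (W ++ W) ++ q) := by
  have hdouble {P : Probe} (hP : ∀ c ∉ F.fixed, ∃ a, P.ψ c = a ++ a) :
      P.Holds F.word (p ++ W ++ M ++ W ++ q) ↔
        P.Holds F.word (p ++ (W ++ W) ++ M ++ (W ++ W) ++ q) := by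
    have hPW : ∀ c ∈ W, ∃ a, P.ψ c = a ++ a := fun c hc => hP c fun h => hW c h hc
    rw [Probe.holds_square hPW (p ++ (W ++ W) ++ M) q]
    simpa only [List.append_assoc] using (Probe.holds_square hPW p (M ++ W ++ q)).symm
  refine and_congr (forall_congr' fun P => forall_congr' fun hP => imp_congr_right fun _ =>
    hdouble hP) (not_congr (hdouble fun c hc => ?_))
  simp only [fixed, List.mem_cons, not_or] at hc
  exact ⟨[], by simp [SplitWord.sqProbe, hc]⟩

theorem not_mem_of_fresh (hc : c ∈ [F.ξ, F.ξ', F.μ, F.μ', F.ν, F.ν']) :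
    c ∉ F.pre ∧ c ∉ F.core ∧ c ∉ F.suf := by
  simpa [and_assoc] using F.fresh c hc

theorem count_gen_of_fresh (hc : c ∈ [F.ξ, F.ξ', F.μ, F.μ', F.ν, F.ν']) :
    (F.gen [F.ξ] [F.ξ']).count c = 1 + [F.ξ, F.ξ', F.μ, F.ν].count c := by
  obtain ⟨hpre, hcore, hsuf⟩ := not_mem_of_fresh hc
  rw [← List.count_eq_one_of_mem F.nodup_fresh hc]
  simp only [gen, List.count_append, List.count_cons, List.count_nil,
    List.count_eq_zero_of_not_mem hpre, List.count_eq_zero_of_not_mem hcore,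
    List.count_eq_zero_of_not_mem hsuf]
  omega

theorem count_gen_eq_two (hc : c ∈ [F.ξ, F.ξ', F.μ, F.ν]) : (F.gen [F.ξ] [F.ξ']).count c = 2 := by
  have hsub : List.Sublist [F.ξ, F.ξ', F.μ, F.ν] [F.ξ, F.ξ', F.μ, F.μ', F.ν, F.ν'] := by simp
  rw [count_gen_of_fresh (hsub.subset hc),
    List.count_eq_one_of_mem (F.nodup_fresh.sublist hsub) hc]

theorem count_ν'_gen : (F.gen [F.ξ] [F.ξ']).count F.ν' = 1 := by
  have h := F.nodup_fresh
  simp only [List.nodup_cons, List.mem_cons, List.not_mem_nil, or_false, not_or] at h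
  rw [count_gen_of_fresh (by simp), List.count_eq_zero_of_not_mem (by simp; grind)]

theorem count_gen (hc : c ∉ [F.ξ, F.ξ', F.μ, F.μ', F.ν, F.ν']) :
    (F.gen [F.ξ] [F.ξ']).count c = (F.pre ++ F.core ++ F.suf).count c := by
  simp only [List.mem_cons, List.not_mem_nil, or_false, not_or, ← ne_eq] at hc
  simp [gen, hc.1.symm, hc.2.1.symm, hc.2.2.1.symm, hc.2.2.2.1.symm, hc.2.2.2.2.1.symm,
    hc.2.2.2.2.2.symm]

theorem firstLT_ν_gen {X : List Letter} (hc : c ∉ F.pre ++ [F.μ, F.μ'] ++ X ++ [F.ν])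
    (X' : List Letter) : FirstLT (F.gen X X') F.ν c := by
  simpa [gen] using firstLT_append_of_mem (q := X' ++ F.core ++ X ++ [F.μ] ++ X' ++ [F.ν', F.ν] ++
    F.suf) (c := F.ν) (by simp) hc

theorem lastLT_gen (hc : c ∉ [F.ν', F.ν] ++ F.suf) (X X' : List Letter) :
    LastLT (F.gen X X') c F.ν' := by
  rw [gen, List.append_assoc _ [F.ν', F.ν]]
  exact lastLT_append_of_mem hc (by simp)

theorem lastLT_ν'_ν_gen (X X' : List Letter) : LastLT (F.gen X X') F.ν' F.ν := by
  have hsuf : F.ν' ∉ F.suf := (not_mem_of_fresh (by simp)).2.2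
  have hne : F.ν' ≠ F.ν := by
    have h := F.nodup_fresh
    simp only [List.nodup_cons, List.mem_cons, not_or] at h
    exact Ne.symm h.2.2.2.2.1.1
  have hsplit : F.gen X X' = F.pre ++ [F.μ, F.μ'] ++ X ++ [F.ν] ++ X' ++ F.core ++ X ++ [F.μ] ++
      X' ++ [F.ν'] ++ ([F.ν] ++ F.suf) := by
    simp [gen]
  rw [hsplit]
  exact lastLT_append_of_mem (by simp [hne, hsuf]) (by simp)

theorem lastLT_ν_gen (hc : c ∈ F.suf) (X X' : List Letter) : LastLT (F.gen X X') F.ν c := by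
  have hν : F.ν ∉ F.suf := (not_mem_of_fresh (by simp)).2.2
  exact lastLT_append_of_mem hν hc

theorem wordProbe_holds_gen : (F.wordProbe F.ξ).Holds F.word (F.gen [F.ξ] [F.ξ']) := by
  have hψξ : (F.wordProbe F.ξ).ψ F.ξ = [x] := if_pos rfl
  have hψ {c : Letter} (hc : c ∈ [F.ξ', F.μ, F.μ', F.ν, F.ν']) : (F.wordProbe F.ξ).ψ c = [] := by
    obtain ⟨hpre, hcore, hsuf⟩ := not_mem_of_fresh (List.mem_cons_of_mem F.ξ hc)
    have hne : c ≠ F.ξ := ne_of_mem_of_not_mem hc (List.nodup_cons.1 F.nodup_fresh).1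
    simp [SplitWord.wordProbe, hpre, hcore, hsuf, hne]
  have hξ : F.ξ ∉ F.pre ∧ F.ξ ∉ F.core ∧ F.ξ ∉ F.suf := not_mem_of_fresh (by simp)
  have hpre : F.pre.flatMap (F.wordProbe F.ξ).ψ = F.pre :=
    SplitWord.wordProbe_flatMap_of_subset (by simp) hξ.1
  have hsuf : F.suf.flatMap (F.wordProbe F.ξ).ψ = F.suf :=
    SplitWord.wordProbe_flatMap_of_subset (by simp) hξ.2.2
  have hcore := SplitWord.aperiodicClass_wordProbe_core hξ.2.1
  have heval : (F.wordProbe F.ξ).eval (F.gen [F.ξ] [F.ξ']) =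
      F.pre ++ [x] ++ F.core.flatMap (F.wordProbe F.ξ).ψ ++ [x] ++ F.suf := by
    have hleft : (F.wordProbe F.ξ).left = [] := rfl
    have hright : (F.wordProbe F.ξ).right = [] := rfl
    simp [Probe.eval, gen, hpre, hsuf, hψξ, hψ, hleft, hright]
  rw [Probe.Holds, heval, SplitWord.word]
  simp only [aperiodicClass_append, hcore]

theorem wordProbe_square (hc : c ∉ F.fixed) : ∃ a, (F.wordProbe F.ξ).ψ c = a ++ a := by
  simp only [fixed, List.mem_cons, not_or] at hc
  by_cases hcore : c ∈ F.core
  · exact ⟨[c], by simp [SplitWord.wordProbe, hc.1, List.mem_append.not.1 hc.2.2.2, hcore]⟩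
  · exact ⟨[], by simp [SplitWord.wordProbe, hc.1, List.mem_append.not.1 hc.2.2.2, hcore]⟩

theorem y_not_mem_fresh : y F.h ∉ [F.ξ, F.ξ', F.μ, F.μ', F.ν, F.ν'] :=
  fun h => (not_mem_of_fresh h).2.1 (by simp [SplitWord.core])

theorem t_not_mem_fresh (hj : j ∈ F.J) : t j ∉ [F.ξ, F.ξ', F.μ, F.μ', F.ν, F.ν'] :=
  fun h => (not_mem_of_fresh h).2.2 (SplitWord.t_mem_suf.2 hj)

theorem sqProbe_holds_gen (hc : c = y F.h ∨ c = F.ξ') :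
    (F.sqProbe F.ν c F.ν').Holds F.word (F.gen [F.ξ] [F.ξ']) := by
  have hfresh := F.nodup_fresh
  simp only [List.nodup_cons, List.mem_cons, List.not_mem_nil, or_false, not_or] at hfresh
  have hcount : (F.gen [F.ξ] [F.ξ']).count c = 2 := by
    rcases hc with rfl | rfl
    · simp [count_gen y_not_mem_fresh, SplitWord.count_y_core,
        List.count_eq_zero_of_not_mem SplitWord.y_not_mem_pre,
        List.count_eq_zero_of_not_mem SplitWord.y_not_mem_suf]
    · exact count_gen_eq_two (by simp)
  have hne : c ∉ [F.ξ, F.μ, F.μ', F.ν, F.ν'] := by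
    rcases hc with rfl | rfl
    · have := F.y_not_mem_fresh
      simp only [List.mem_cons, List.not_mem_nil, or_false, not_or] at this ⊢
      exact ⟨this.1, this.2.2⟩
    · simp only [List.mem_cons, List.not_mem_nil, or_false, not_or]
      exact ⟨Ne.symm hfresh.1.1, hfresh.2.1⟩
  have hc' : c ∉ F.pre ∧ c ∉ F.suf := by
    rcases hc with rfl | rfl
    · exact ⟨SplitWord.y_not_mem_pre, SplitWord.y_not_mem_suf⟩
    · exact (not_mem_of_fresh (by simp)).imp_right And.right
  simp only [List.mem_cons, List.not_mem_nil, or_false, not_or] at hne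
  have hν' := not_mem_of_fresh (F := F) (c := F.ν') (by simp)
  exact SplitWord.sqProbe_holds (count_gen_eq_two (by simp)) hcount count_ν'_gen
    (firstLT_ν_gen (by simp [hne, hc']) _) (firstLT_ν_gen (by
      simp [hν', Ne.symm hfresh.1.2.2.2.2, Ne.symm hfresh.2.2.1.2.2, Ne.symm hfresh.2.2.2.1.2,
        Ne.symm hfresh.2.2.2.2.1]) _)
    (lastLT_gen (by simp [hne, hc']) _ _) (lastLT_ν'_ν_gen _ _)

theorem tailProbe_ξ_holds_gen : (F.tailProbe F.ξ F.ν').Holds F.word (F.gen [F.ξ] [F.ξ']) := by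
  have hfresh := F.nodup_fresh
  simp only [List.nodup_cons, List.mem_cons, List.not_mem_nil, or_false, not_or] at hfresh
  have hξ := not_mem_of_fresh (F := F) (c := F.ξ) (by simp)
  exact SplitWord.tailProbe_holds (count_gen_eq_two (by simp)) count_ν'_gen
    (lastLT_gen (by simp [hξ, hfresh]) _ _)

theorem tailProbe_ν_holds_gen (hj : j ∈ F.J) :
    (F.tailProbe F.ν (t j)).Holds F.word (F.gen [F.ξ] [F.ξ']) := by
  have hcount : (F.gen [F.ξ] [F.ξ']).count (t j) = 1 := by
    have h := SplitWord.count_t_word (List.mem_append_right F.I hj)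
    rw [count_gen (t_not_mem_fresh hj)]
    simpa [SplitWord.word] using h
  exact SplitWord.tailProbe_holds (count_gen_eq_two (by simp)) hcount
    (lastLT_ν_gen (SplitWord.t_mem_suf.2 hj) _ _)

theorem tracks_self (hc : c ∈ F.pre ++ F.core ++ F.suf) : (F.wordProbe F.ξ).Tracks c c := by
  refine SplitWord.wordProbe_tracks_self ?_ (ne_of_mem_of_not_mem hc (F.fresh F.ξ (by simp)))
  simp only [List.mem_append] at hc ⊢
  tauto

theorem tracks_z (hi : i ∈ F.I ++ F.J) : (F.wordProbe F.ξ).Tracks (z i) (z i) :=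
  tracks_self (by simpa [SplitWord.z_mem_core] using .inr (.inl (List.mem_append.1 hi)))

theorem tracks_t (hi : i ∈ F.I ++ F.J) : (F.wordProbe F.ξ).Tracks (t i) (t i) :=
  tracks_self (by
    simpa [SplitWord.t_mem_pre, SplitWord.t_not_mem_core, SplitWord.t_mem_suf] using hi)

theorem tracks_y : (F.wordProbe F.ξ).Tracks (y F.h) (y F.h) :=
  tracks_self (by simp [SplitWord.core])

theorem count_wordProbe_self_eq_one (hc : c ∈ F.pre ++ F.suf) :
    ((F.wordProbe F.ξ).ψ c).count c = 1 := by
  have hcξ : c ≠ F.ξ := by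
    refine ne_of_mem_of_not_mem hc ?_
    have := not_mem_of_fresh (F := F) (c := F.ξ) (by simp)
    simp [this]
  have hψ : (F.wordProbe F.ξ).ψ c = [c] := (if_neg hcξ).trans (if_pos hc)
  simp [hψ]

theorem ξ_ne_ν (F : Frame) : F.ξ ≠ F.ν :=
  fun h => (List.nodup_cons.1 F.nodup_fresh).1 (by simp [h])

theorem ξ_ne_ν' (F : Frame) : F.ξ ≠ F.ν' :=
  fun h => (List.nodup_cons.1 F.nodup_fresh).1 (by simp [h])

theorem ξ_ne_z (hj : j ∈ F.J) : F.ξ ≠ z j :=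
  (ne_of_mem_of_not_mem (SplitWord.z_mem_suf.2 hj) (not_mem_of_fresh (by simp)).2.2).symm

namespace Left

theorem wordProbe_holds (hU : F.Left U) : (F.wordProbe F.ξ).Holds F.word U :=
  hU.1 _ (fun _ => wordProbe_square) wordProbe_holds_gen

theorem sqProbe_holds (hU : F.Left U) (hc : c = y F.h ∨ c = F.ξ') :
    (F.sqProbe F.ν c F.ν').Holds F.word U := by
  refine hU.1 _ (fun e he => ?_) (sqProbe_holds_gen hc)
  simp only [fixed, List.mem_cons, not_or] at he
  by_cases hec : e = c
  · exact ⟨[y F.h], by simp [SplitWord.sqProbe, he, ← hec]⟩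
  · exact ⟨[], by simp [SplitWord.sqProbe, he, hec]⟩

theorem tailProbe_holds (hU : F.Left U) {d e : Letter} (he : e ∈ F.fixed)
    (h : (F.tailProbe d e).Holds F.word (F.gen [F.ξ] [F.ξ'])) :
    (F.tailProbe d e).Holds F.word U := by
  refine hU.1 _ (fun c hc => ?_) h
  have hce : c ≠ e := (ne_of_mem_of_not_mem he hc).symm
  by_cases hcd : c = d
  · exact ⟨[y F.h], by simp [SplitWord.tailProbe, hcd]⟩
  · exact ⟨[], by simp [SplitWord.tailProbe, hcd, hce]⟩

variable (hU : F.Left U)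
include hU

theorem lastLT_ξ_ν' : LastLT U F.ξ F.ν' :=
  SplitWord.lastLT_of_tailProbe_holds F.ξ_ne_ν'
    (hU.tailProbe_holds (by simp [fixed]) tailProbe_ξ_holds_gen)

theorem lastLT_ν_t (hj : j ∈ F.J) : LastLT U F.ν (t j) := by
  have hne : F.ν ≠ t j := ne_of_mem_of_not_mem (by simp) (t_not_mem_fresh hj)
  refine SplitWord.lastLT_of_tailProbe_holds hne
    (hU.tailProbe_holds ?_ (tailProbe_ν_holds_gen hj))
  simp [fixed, SplitWord.t_mem_suf, hj]

theorem orders_ν (hc : c = y F.h ∨ c = F.ξ') : (U.count F.ν = 2 ∧ U.count F.ν' = 1) ∧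
    (FirstLT U F.ν c ∧ FirstLT U F.ν F.ν') ∧ LastLT U c F.ν' ∧ LastLT U F.ν' F.ν := by
  have hfresh := F.nodup_fresh
  simp only [List.nodup_cons, List.mem_cons, List.not_mem_nil, or_false, not_or] at hfresh
  have hcν : F.ν ≠ c ∧ c ≠ F.ν' := by
    rcases hc with rfl | rfl
    · exact ⟨ne_of_mem_of_not_mem (by simp) F.y_not_mem_fresh,
        (ne_of_mem_of_not_mem (by simp) F.y_not_mem_fresh).symm⟩
    · exact ⟨Ne.symm hfresh.2.1.2.2.1, hfresh.2.1.2.2.2⟩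
  exact SplitWord.orders_of_sqProbe_holds hcν.1 hfresh.2.2.2.2.1 hcν.2 (hU.sqProbe_holds hc)

theorem count_ν : U.count F.ν = 2 :=
  (hU.orders_ν (.inl rfl)).1.1

theorem count_ν' : U.count F.ν' = 1 :=
  (hU.orders_ν (.inl rfl)).1.2

theorem firstLT_ν_ν' : FirstLT U F.ν F.ν' :=
  (hU.orders_ν (.inl rfl)).2.1.2

theorem lastLT_ν'_ν : LastLT U F.ν' F.ν :=
  (hU.orders_ν (.inl rfl)).2.2.2

theorem firstLT_ν_y : FirstLT U F.ν (y F.h) :=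
  (hU.orders_ν (.inl rfl)).2.1.1

theorem firstLT_ν_ξ' : FirstLT U F.ν F.ξ' :=
  (hU.orders_ν (.inr rfl)).2.1.1

theorem lastLT_ξ'_ν' : LastLT U F.ξ' F.ν' :=
  (hU.orders_ν (.inr rfl)).2.2.1

theorem count_ξ : U.count F.ξ = 2 :=
  (hU.wordProbe_holds.count_eq SplitWord.wordProbe_tracks_x SplitWord.rigid_x
    (by simp [SplitWord.wordProbe])).trans SplitWord.count_x_word

theorem firstLT_ξ_ν : FirstLT U F.ξ F.ν := by
  by_contra h
  have hξ : F.ξ ∈ U := List.count_pos_iff.1 (hU.count_ξ.symm ▸ Nat.two_pos)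
  exact hU.2 (SplitWord.sqProbe_holds hU.count_ν hU.count_ξ hU.count_ν'
    ((firstLT_or_firstLT hξ F.ξ_ne_ν).resolve_left h) hU.firstLT_ν_ν' hU.lastLT_ξ_ν' hU.lastLT_ν'_ν)

theorem firstLT_ξ_ξ' : FirstLT U F.ξ F.ξ' :=
  hU.firstLT_ξ_ν.trans hU.firstLT_ν_ξ'

theorem count_z (hi : i ∈ F.I ++ F.J) : U.count (z i) = 2 :=
  (hU.wordProbe_holds.count_eq (tracks_z hi) (SplitWord.rigid_z hi)
    (count_wordProbe_self_eq_one (by simpa [SplitWord.z_mem_pre, SplitWord.z_mem_suf] using hi)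
      )).trans (SplitWord.count_z_word hi)

theorem count_t (hi : i ∈ F.I ++ F.J) : U.count (t i) = 1 :=
  (hU.wordProbe_holds.count_eq (tracks_t hi) (SplitWord.rigid_t hi)
    (count_wordProbe_self_eq_one (by simpa [SplitWord.t_mem_pre, SplitWord.t_mem_suf] using hi)
      )).trans (SplitWord.count_t_word hi)

theorem firstLT_z_t (hi : i ∈ F.I ++ F.J) : FirstLT U (z i) (t i) :=
  (hU.wordProbe_holds.firstLT_iff (tracks_z hi) (tracks_t hi) nofun
    (.inr (SplitWord.rigid_t hi))).2 (SplitWord.firstLT_z_t hi)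

theorem lastLT_t_z (hi : i ∈ F.I ++ F.J) : LastLT U (t i) (z i) :=
  (hU.wordProbe_holds.lastLT_iff (tracks_t hi) (tracks_z hi) nofun
    (.inl (SplitWord.rigid_t hi))).2 (SplitWord.lastLT_t_z hi)

theorem firstLT_ξ_z (hj : j ∈ F.J) : FirstLT U F.ξ (z j) :=
  (hU.wordProbe_holds.firstLT_iff SplitWord.wordProbe_tracks_x
    (tracks_z (List.mem_append_right _ hj)) (ξ_ne_z hj) (.inl SplitWord.rigid_x)).2
    (SplitWord.firstLT_x_z hj)

theorem lastLT_ξ_z (hj : j ∈ F.J) : LastLT U F.ξ (z j) :=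
  (hU.wordProbe_holds.lastLT_iff SplitWord.wordProbe_tracks_x
    (tracks_z (List.mem_append_right _ hj)) (ξ_ne_z hj) (.inl SplitWord.rigid_x)).2
    (SplitWord.lastLT_x_z hj)

theorem firstLT_z_y (hj : j ∈ F.J) : FirstLT U (z j) (y F.h) :=
  (hU.wordProbe_holds.firstLT_iff (tracks_z (List.mem_append_right _ hj)) tracks_y nofun
    (.inl (SplitWord.rigid_z (List.mem_append_right _ hj)))).2 (SplitWord.firstLT_z_y hj)

theorem lastLT_y_ξ : LastLT U (y F.h) F.ξ :=
  (hU.wordProbe_holds.lastLT_iff tracks_y SplitWord.wordProbe_tracks_x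
    (ne_of_mem_of_not_mem (by simp) y_not_mem_fresh).symm (.inr SplitWord.rigid_x)).2
    SplitWord.lastLT_y_x

theorem y_mem : y F.h ∈ U :=
  ((hU.wordProbe_holds.firstLT_iff tracks_y (tracks_t (List.mem_append_right _ F.κ_mem_J)) nofun
    (.inr (SplitWord.rigid_t (List.mem_append_right _ F.κ_mem_J)))).2
    (SplitWord.firstLT_y_t F.κ_mem_J)).mem

theorem pairwise_separated : (F.ν :: F.J.map z).Pairwise (Separated U) := by
  have hJ {j : ℕ} (hj : j ∈ F.J) := List.mem_append_right F.I hj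
  refine List.pairwise_cons.2 ⟨fun d hd => ?_, List.pairwise_map.2 ?_⟩
  · obtain ⟨j, hj, rfl⟩ := List.mem_map.1 hd
    exact ⟨t j, hU.count_t (hJ hj), hU.lastLT_ν_t hj, hU.lastLT_t_z (hJ hj)⟩
  · refine (SplitWord.pairwise_lastLT_z_t (S := F.toSplitWord)).imp_of_mem fun {i j} hi hj h => ?_
    refine ⟨t j, hU.count_t (hJ hj), ?_, hU.lastLT_t_z (hJ hj)⟩
    exact (hU.wordProbe_holds.lastLT_iff (tracks_z (hJ hi)) (tracks_t (hJ hj)) nofun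
      (.inr (SplitWord.rigid_t (hJ hj)))).2 h

theorem orders_of_mem {d : Letter} (hd : d ∈ F.ν :: F.J.map z) : U.count d = 2 ∧
    FirstLT U F.ξ d ∧ FirstLT U d (y F.h) ∧ LastLT U F.ξ d := by
  rcases List.mem_cons.1 hd with rfl | hd
  · exact ⟨hU.count_ν, hU.firstLT_ξ_ν, hU.firstLT_ν_y, hU.lastLT_ξ_ν'.trans hU.lastLT_ν'_ν⟩
  · obtain ⟨j, hj, rfl⟩ := List.mem_map.1 hd
    exact ⟨hU.count_z (List.mem_append_right _ hj), hU.firstLT_ξ_z hj, hU.firstLT_z_y hj,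
      hU.lastLT_ξ_z hj⟩

theorem anchored (hc : c ∈ F.fixed) (hcξ : c ≠ F.ξ) : Anchored U c := by
  have hz {i : ℕ} (hi : i ∈ F.I ++ F.J) : Anchored U (z i) :=
    .inr ⟨hU.count_z hi, t i, hU.count_t hi, hU.firstLT_z_t hi, hU.lastLT_t_z hi⟩
  simp only [fixed, SplitWord.pre, SplitWord.suf, List.mem_cons, List.mem_append,
    List.mem_flatMap, List.not_mem_nil, or_false] at hc
  rcases hc with rfl | rfl | rfl | ⟨i, hi, rfl | rfl⟩ | ⟨i, hi, rfl | rfl⟩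
  · exact absurd rfl hcξ
  · exact .inr ⟨hU.count_ν, F.ν', hU.count_ν', hU.firstLT_ν_ν', hU.lastLT_ν'_ν⟩
  · exact .inl hU.count_ν'
  · exact hz (List.mem_append_left _ hi)
  · exact .inl (hU.count_t (List.mem_append_left _ hi))
  · exact .inl (hU.count_t (List.mem_append_right _ hi))
  · exact hz (List.mem_append_right _ hi)

theorem count_le_two (hc : c ∈ F.fixed) : U.count c ≤ 2 := by
  by_cases hcξ : c = F.ξ
  · exact hcξ ▸ hU.count_ξ.le
  · rcases hU.anchored hc hcξ with h | h
    · omega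
    · exact h.1.le

end Left


theorem mem_pre_or_of_mem_core {a : Letter} (ha : a ∈ F.core) :
    a ∈ F.pre ∨ 2 ≤ F.core.count a ∨ a ∈ F.J.map z ∧ a ∈ F.suf := by
  rcases SplitWord.exists_eq_z_or_two_le_count_core ha with ⟨i, rfl⟩ | h
  · rcases SplitWord.z_mem_core.1 ha with hi | hi
    · exact .inl (SplitWord.z_mem_pre.2 hi)
    · exact .inr (.inr ⟨List.mem_map_of_mem hi, SplitWord.z_mem_suf.2 hi⟩)
  · exact .inr (.inl h)

theorem mem_left_or_of_mem_middle_ξ' {a : Letter} {X : List Letter}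
    (ha : a ∈ F.core ++ X ++ [F.μ]) :
    a ∈ F.pre ++ [F.μ, F.μ'] ++ X ++ [F.ν] ∨ 2 ≤ (F.core ++ X ++ [F.μ]).count a ∨
      a ∈ F.J.map z ∧ a ∈ [F.ν', F.ν] ++ F.suf := by
  rcases List.mem_append.1 ha with ha | ha
  · rcases List.mem_append.1 ha with ha | ha
    · rcases mem_pre_or_of_mem_core ha with h | h | h
      · simp [h]
      · exact .inr (.inl (h.trans (by simp [List.count_append])))
      · exact .inr (.inr ⟨h.1, by simp [h.2]⟩)
    · simp [ha]
  · simp [List.mem_singleton.1 ha]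

theorem mem_left_or_of_mem_middle_ξ {a : Letter} (ha : a ∈ [F.ν] ++ [F.ξ', F.ξ'] ++ F.core) :
    a ∈ F.pre ++ [F.μ, F.μ'] ∨ 2 ≤ ([F.ν] ++ [F.ξ', F.ξ'] ++ F.core).count a ∨
      a ∈ F.ν :: F.J.map z ∧ a ∈ [F.μ] ++ [F.ξ', F.ξ'] ++ [F.ν', F.ν] ++ F.suf := by
  rcases List.mem_append.1 ha with ha | ha
  · rcases List.mem_append.1 ha with ha | ha
    · simp [List.mem_singleton.1 ha]
    · obtain rfl : a = F.ξ' := by simpa using ha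
      have hsub : List.Sublist [F.ξ', F.ξ'] ([F.ν] ++ [F.ξ', F.ξ'] ++ F.core) := by simp
      exact .inr (.inl ((by simp : 2 ≤ [F.ξ', F.ξ'].count F.ξ').trans (hsub.count_le _)))
  · rcases mem_pre_or_of_mem_core ha with h | h | h
    · simp [h]
    · exact .inr (.inl (h.trans ((List.sublist_append_right _ _).count_le a)))
    · exact .inr (.inr ⟨by simp [h.1], by simp [h.2]⟩)

theorem Left.ν_cons_z_subset_fixed : F.ν :: F.J.map z ⊆ F.fixed := by
  intro d hd
  rcases List.mem_cons.1 hd with rfl | hd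
  · simp [fixed]
  · obtain ⟨j, hj, rfl⟩ := List.mem_map.1 hd
    simp [fixed, SplitWord.z_mem_suf.2 hj]

section Blocks

variable {θ : Letter → List Letter} {l r : List Letter} {X : List Letter}

theorem not_mem_block_ξ' (hU : F.Left (l ++ (F.gen X [F.ξ']).flatMap θ ++ r))
    (hc : c ∈ F.fixed) : c ∉ θ F.ξ' := by
  have hgen : l ++ (F.gen X [F.ξ']).flatMap θ ++ r = blockWord θ l (F.pre ++ [F.μ, F.μ'] ++ X ++
      [F.ν]) F.ξ' (F.core ++ X ++ [F.μ]) ([F.ν', F.ν] ++ F.suf) r := by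
    simp [gen, blockWord]
  rw [hgen] at hU
  have hA₂ := fun a => F.mem_left_or_of_mem_middle_ξ' (X := X) (a := a)
  have hanchored {c : Letter} (hc : c ∈ F.fixed) (hcξ : c ≠ F.ξ) : c ∉ θ F.ξ' :=
    (hU.anchored hc hcξ).not_mem_block fun _ => two_le_count_of_mem_middle hA₂
  rcases eq_or_ne c F.ξ with rfl | hcξ
  · refine not_mem_block_of_pairwise_separated hA₂ (H := F.ν :: F.J.map z) (by simp)
      hU.pairwise_separated (fun d hd => ?_) (fun _ => hU.orders_of_mem) hU.count_ξ hU.y_mem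
      hU.lastLT_y_ξ
    exact hanchored (Left.ν_cons_z_subset_fixed hd) (hU.orders_of_mem hd).2.1.ne.symm
  · exact hanchored hc hcξ

theorem left_iff_double_ξ' (h : ∀ c ∈ F.fixed, c ∉ θ F.ξ') :
    F.Left (l ++ (F.gen X [F.ξ']).flatMap θ ++ r) ↔
      F.Left (l ++ (F.gen X [F.ξ', F.ξ']).flatMap θ ++ r) := by
  simpa [gen] using Left.double_iff h (l ++ (F.pre ++ [F.μ, F.μ'] ++ X ++ [F.ν]).flatMap θ)
    ((F.core ++ X ++ [F.μ]).flatMap θ) (([F.ν', F.ν] ++ F.suf).flatMap θ ++ r)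

theorem left_gen_iff_double_ξ' : F.Left (l ++ (F.gen X [F.ξ']).flatMap θ ++ r) ↔
    F.Left (l ++ (F.gen X [F.ξ', F.ξ']).flatMap θ ++ r) := by
  refine ⟨fun hU => (left_iff_double_ξ' fun _ => not_mem_block_ξ' hU).1 hU,
    fun hU => (left_iff_double_ξ' fun c hc hcθ => ?_).2 hU⟩
  have hle := hU.count_le_two hc
  have := List.count_pos_iff.2 hcθ
  simp only [gen, List.flatMap_append, List.flatMap_cons, List.flatMap_nil,
    List.count_append] at hle
  omega

/-- The reversal of the condition `Left`. -/
def Right (F : Frame) (U : List Letter) : Prop := F.rev.Left U.reverse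

theorem reverse_append_gen_append (X X' : List Letter) :
    (l ++ (F.gen X X').flatMap θ ++ r).reverse = r.reverse ++
      (F.rev.gen X'.reverse X.reverse).flatMap (fun c => (θ c).reverse) ++ l.reverse := by
  simp [← reverse_gen, List.reverse_flatMap, Function.comp_def]

theorem right_gen_iff_double_ξ : F.Right (l ++ (F.gen [F.ξ] X).flatMap θ ++ r) ↔
    F.Right (l ++ (F.gen [F.ξ, F.ξ] X).flatMap θ ++ r) := by
  rw [Right, Right, reverse_append_gen_append, reverse_append_gen_append]
  exact left_gen_iff_double_ξ'

theorem Left.pairwise_separated_cons (hU : F.Left U) :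
    (F.ξ' :: F.ν :: F.J.map z).Pairwise (Separated U) := by
  refine List.pairwise_cons.2 ⟨fun d hd => ?_, hU.pairwise_separated⟩
  rcases List.mem_cons.1 hd with rfl | hd
  · exact ⟨F.ν', hU.count_ν', hU.lastLT_ξ'_ν', hU.lastLT_ν'_ν⟩
  · obtain ⟨j, hj, rfl⟩ := List.mem_map.1 hd
    have hj' := List.mem_append_right F.I hj
    exact ⟨t j, hU.count_t hj', (hU.lastLT_ξ'_ν'.trans hU.lastLT_ν'_ν).trans (hU.lastLT_ν_t hj),
      hU.lastLT_t_z hj'⟩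

theorem not_mem_block_ξ (hU : F.Left (l ++ (F.gen [F.ξ] [F.ξ', F.ξ']).flatMap θ ++ r))
    (hU' : F.Right (l ++ (F.gen [F.ξ] [F.ξ', F.ξ']).flatMap θ ++ r)) (hc : c ∈ F.fixed) :
    c ∉ θ F.ξ := by
  have hξ' : F.ξ' ∉ θ F.ξ := by
    have h : F.rev.Left _ := hU'
    rw [reverse_append_gen_append] at h
    exact List.mem_reverse.not.1 (not_mem_block_ξ' (c := F.ξ') h List.mem_cons_self)
  have horders : (l ++ (F.gen [F.ξ] [F.ξ', F.ξ']).flatMap θ ++ r).count F.ξ' = 2 ∧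
      FirstLT (l ++ (F.gen [F.ξ] [F.ξ', F.ξ']).flatMap θ ++ r) F.ξ' (y F.h) ∧
      LastLT (l ++ (F.gen [F.ξ] [F.ξ', F.ξ']).flatMap θ ++ r) F.ξ F.ξ' :=
    ⟨List.count_reverse.symm.trans (Left.count_ξ hU'), lastLT_reverse.1 (Left.lastLT_y_ξ hU'),
      firstLT_reverse.1 (Left.firstLT_ξ_ξ' hU')⟩
  have hgen : l ++ (F.gen [F.ξ] [F.ξ', F.ξ']).flatMap θ ++ r = blockWord θ l
      (F.pre ++ [F.μ, F.μ']) F.ξ ([F.ν] ++ [F.ξ', F.ξ'] ++ F.core)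
      ([F.μ] ++ [F.ξ', F.ξ'] ++ [F.ν', F.ν] ++ F.suf) r := by
    simp [gen, blockWord]
  rw [hgen] at hU horders
  have hA₂ := fun a => F.mem_left_or_of_mem_middle_ξ (a := a)
  have hanchored {c : Letter} (hc : c ∈ F.fixed) (hcξ : c ≠ F.ξ) : c ∉ θ F.ξ :=
    (hU.anchored hc hcξ).not_mem_block fun _ => two_le_count_of_mem_middle hA₂
  rcases eq_or_ne c F.ξ with rfl | hcξ
  · refine not_mem_block_of_pairwise_separated hA₂ (H := F.ξ' :: F.ν :: F.J.map z) (by simp)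
      hU.pairwise_separated_cons (fun d hd => ?_) (fun d hd => ?_) hU.count_ξ hU.y_mem
      hU.lastLT_y_ξ
    · rcases List.mem_cons.1 hd with rfl | hd
      · exact hξ'
      · exact hanchored (Left.ν_cons_z_subset_fixed hd) (hU.orders_of_mem hd).2.1.ne.symm
    · rcases List.mem_cons.1 hd with rfl | hd
      · exact ⟨horders.1, hU.firstLT_ξ_ξ', horders.2⟩
      · exact hU.orders_of_mem hd
  · exact hanchored hc hcξ

theorem left_iff_double_ξ {X' : List Letter} (h : ∀ c ∈ F.fixed, c ∉ θ F.ξ) :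
    F.Left (l ++ (F.gen [F.ξ] X').flatMap θ ++ r) ↔
      F.Left (l ++ (F.gen [F.ξ, F.ξ] X').flatMap θ ++ r) := by
  simpa [gen] using Left.double_iff h (l ++ (F.pre ++ [F.μ, F.μ']).flatMap θ)
    (([F.ν] ++ X' ++ F.core).flatMap θ)
    (([F.μ] ++ X' ++ [F.ν', F.ν] ++ F.suf).flatMap θ ++ r)

theorem left_and_right_gen_iff_double_ξ :
    F.Left (l ++ (F.gen [F.ξ] [F.ξ', F.ξ']).flatMap θ ++ r) ∧
      F.Right (l ++ (F.gen [F.ξ] [F.ξ', F.ξ']).flatMap θ ++ r) ↔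
    F.Left (l ++ (F.gen [F.ξ, F.ξ] [F.ξ', F.ξ']).flatMap θ ++ r) ∧
      F.Right (l ++ (F.gen [F.ξ, F.ξ] [F.ξ', F.ξ']).flatMap θ ++ r) := by
  refine ⟨fun ⟨hU, hU'⟩ => ⟨?_, right_gen_iff_double_ξ.1 hU'⟩,
    fun ⟨hU, hU'⟩ => ⟨?_, right_gen_iff_double_ξ.2 hU'⟩⟩
  · exact (left_iff_double_ξ fun _ => not_mem_block_ξ hU hU').1 hU
  · refine (left_iff_double_ξ fun c hc hcθ => ?_).2 hU
    have hle := hU.count_le_two hc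
    have := List.count_pos_iff.2 hcθ
    simp only [gen, List.flatMap_append, List.flatMap_cons, List.flatMap_nil,
      List.count_append] at hle
    omega

end Blocks

theorem left_gen : F.Left (F.gen [F.ξ] [F.ξ']) := by
  refine ⟨fun _ _ h => h, fun h => ?_⟩
  have hlt : FirstLT (F.gen [F.ξ] [F.ξ']) F.ξ F.ν := by
    have hν : F.ν ∉ F.pre ++ [F.μ, F.μ'] ++ [F.ξ] := by
      have hfresh := F.nodup_fresh
      simp only [List.nodup_cons, List.mem_cons, List.not_mem_nil, or_false, not_or] at hfresh
      simp [(not_mem_of_fresh (F := F) (c := F.ν) (by simp)).1, Ne.symm hfresh.1.2.2.2.1,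
        Ne.symm hfresh.2.2.1.2.1, Ne.symm hfresh.2.2.2.1.1]
    have h := firstLT_append_of_mem (q := [F.ν] ++ [F.ξ'] ++ F.core ++ [F.ξ] ++ [F.μ] ++ [F.ξ'] ++
      [F.ν', F.ν] ++ F.suf) (c := F.ξ) (by simp) hν
    simpa [gen] using h
  have hne : F.ν ≠ F.ν' := (lastLT_ν'_ν_gen [F.ξ] [F.ξ']).ne.symm
  exact hlt.not_firstLT
    (SplitWord.orders_of_sqProbe_holds F.ξ_ne_ν.symm hne F.ξ_ne_ν' h).2.1.1

theorem right_gen : F.Right (F.gen [F.ξ] [F.ξ']) := by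
  rw [Right, reverse_gen]
  exact F.rev.left_gen

theorem not_left_gen_double : ¬ F.Left (F.gen [F.ξ, F.ξ] [F.ξ']) := by
  intro h
  have hcount := h.count_ξ
  simp only [gen, List.append_assoc, List.cons_append, List.nil_append, List.count_append,
    List.count_cons_self, List.count_cons] at hcount
  omega

theorem saturated_left : (sapirVariety alphaOneAperiodic
    {((ofList F.word : Word) : alphaOneAperiodic.Quotient)}).Saturated {U | F.Left (toList U)} :=
  fun _ _ huv => Left.congr fun _ =>
    ⟨Probe.Holds.of_fic huv, Probe.Holds.of_fic ((MonoidVariety.fic _).symm huv)⟩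

theorem saturated_right : (sapirVariety alphaOneAperiodic
    {((ofList F.word : Word) : alphaOneAperiodic.Quotient)}).Saturated
      {U | F.Right (toList U)} := by
  have hword : F.rev.word = F.word.reverse := F.toSplitWord.rev_word
  refine fun u v huv => Left.congr fun P => ?_
  rw [hword, Probe.holds_reverse_reverse, Probe.holds_reverse_reverse]
  exact ⟨Probe.Holds.of_fic huv, Probe.Holds.of_fic ((MonoidVariety.fic _).symm huv)⟩

theorem lift_update_gen {M : Type*} [Monoid M] {X' : List Letter} (hX' : F.ξ ∉ X')
    (φ : Letter → M) : lift (Function.update φ F.ξ (φ F.ξ * φ F.ξ)) (ofList (F.gen [F.ξ] X')) =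
      lift φ (ofList (F.gen [F.ξ, F.ξ] X')) := by
  have hξ := (List.nodup_cons.1 F.nodup_fresh).1
  obtain ⟨hpre, hcore, hsuf⟩ := not_mem_of_fresh (F := F) (c := F.ξ) (by simp)
  have hmap {u : List Letter} (hu : F.ξ ∉ u) :
      u.map (Function.update φ F.ξ (φ F.ξ * φ F.ξ)) = u.map φ :=
    List.map_congr_left fun c hc => Function.update_of_ne (ne_of_mem_of_not_mem hc hu) _ _
  have hfresh {c : Letter} (hc : c ∈ [F.ξ', F.μ, F.μ', F.ν, F.ν']) :
      Function.update φ F.ξ (φ F.ξ * φ F.ξ) c = φ c :=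
    Function.update_of_ne (ne_of_mem_of_not_mem hc hξ) _ _
  simp [lift_apply, gen, hmap hpre, hmap hcore, hmap hsuf, hmap hX', hfresh, mul_assoc]

theorem monoidSatisfies_gen_double {M : Type} [Monoid M]
    (h₀ : MonoidSatisfies M
      (ofList (F.gen [F.ξ] [F.ξ', F.ξ']), ofList (F.gen [F.ξ, F.ξ] [F.ξ', F.ξ'])))
    (h₁ : MonoidSatisfies M (ofList (F.gen [F.ξ] [F.ξ']), ofList (F.gen [F.ξ] [F.ξ', F.ξ']))) :
    MonoidSatisfies M (ofList (F.gen [F.ξ] [F.ξ']), ofList (F.gen [F.ξ, F.ξ] [F.ξ'])) := by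
  have hξ : F.ξ ≠ F.ξ' := fun h => (List.nodup_cons.1 F.nodup_fresh).1 (by simp [h])
  intro φ
  calc lift φ (ofList (F.gen [F.ξ] [F.ξ']))
    _ = lift φ (ofList (F.gen [F.ξ] [F.ξ', F.ξ'])) := h₁ φ
    _ = lift φ (ofList (F.gen [F.ξ, F.ξ] [F.ξ', F.ξ'])) := h₀ φ
    _ = lift (Function.update φ F.ξ (φ F.ξ * φ F.ξ)) (ofList (F.gen [F.ξ] [F.ξ', F.ξ'])) :=
      (lift_update_gen (by simp [hξ]) φ).symm
    _ = lift (Function.update φ F.ξ (φ F.ξ * φ F.ξ)) (ofList (F.gen [F.ξ] [F.ξ'])) := (h₁ _).symm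
    _ = lift φ (ofList (F.gen [F.ξ, F.ξ] [F.ξ'])) := lift_update_gen (by simp [hξ]) φ

theorem not_isDistributive_sapirVariety_word (F : Frame) :
    ¬ (sapirVariety alphaOneAperiodic
      {((ofList F.word : Word) : alphaOneAperiodic.Quotient)}).IsDistributive := by
  refine MonoidVariety.not_isDistributive_of_saturated F.saturated_left F.saturated_right
    (e₀ := (ofList (F.gen [F.ξ] [F.ξ', F.ξ']), ofList (F.gen [F.ξ, F.ξ] [F.ξ', F.ξ'])))
    (e₁ := (ofList (F.gen [F.ξ] [F.ξ']), ofList (F.gen [F.ξ] [F.ξ', F.ξ'])))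
    (e₂ := (ofList (F.gen [F.ξ] [F.ξ']), ofList (F.gen [F.ξ, F.ξ] [F.ξ'])))
    (stable_of_forall_flatMap fun _ _ _ => left_gen_iff_double_ξ')
    (stable_of_forall_flatMap fun _ _ _ => right_gen_iff_double_ξ)
    (stable_of_forall_flatMap (C := fun U => F.Left U ∧ F.Right U)
      fun _ _ _ => left_and_right_gen_iff_double_ξ)
    (u := ofList (F.gen [F.ξ] [F.ξ'])) (v := ofList (F.gen [F.ξ, F.ξ] [F.ξ']))
    ⟨left_gen, right_gen⟩ (fun h => not_left_gen_double h.1)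
    (fun _ => monoidSatisfies_gen_double) fun _ _ h => h

end Frame

end Frames

theorem SplitWord.exists_frame (S : SplitWord) : ∃ F : Frame, F.toSplitWord = S := by
  obtain ⟨N, hN⟩ : BddAbove (Letter.y ⁻¹' {c | c ∈ S.pre ++ S.core ++ S.suf}) :=
    ((List.finite_toSet _).preimage fun _ _ _ _ => Letter.y.inj).bddAbove
  have hfresh {i : ℕ} (hi : N < i) : Letter.y i ∉ S.pre ++ S.core ++ S.suf :=
    fun h => hi.not_ge (hN h)
  refine ⟨⟨S, .y (N + 1), .y (N + 2), .y (N + 3), .y (N + 4), .y (N + 5), .y (N + 6), by simp,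
    fun c hc => ?_⟩, rfl⟩
  simp only [List.mem_cons, List.not_mem_nil, or_false] at hc
  rcases hc with rfl | rfl | rfl | rfl | rfl | rfl <;> exact hfresh (by omega)

theorem SplitWord.not_isDistributive_sapirVariety_alphaOneAperiodic (S : SplitWord) :
    ¬ (sapirVariety alphaOneAperiodic
      {((FreeMonoid.ofList S.word : Word) : alphaOneAperiodic.Quotient)}).IsDistributive := by
  obtain ⟨F, rfl⟩ := S.exists_frame
  exact F.not_isDistributive_sapirVariety_word

section PermutationWords

open Letter FreeMonoid

/-- The index of the letter `z` at the position `i` of the permuted product, where positions are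
counted from `0` and `0` is returned outside the product. -/
def permIndex {N : ℕ} (π : Equiv.Perm (Fin N)) (i : ℕ) : ℕ :=
  if h : i < N then (π ⟨i, h⟩ : ℕ) + 1 else 0

/-- The factor of the permuted product that starts with its letter `z` at the position `i`. -/
def permBlock {N : ℕ} (π : Equiv.Perm (Fin N)) (i : ℕ) : List Letter :=
  z (permIndex π i) :: if i + 1 < N then [y (i + 1), y (i + 1)] else []

theorem permIndex_of_lt {N : ℕ} (π : Equiv.Perm (Fin N)) (i : Fin N) :
    permIndex π i = (π i : ℕ) + 1 :=
  dif_pos i.2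

theorem permIndex_injOn {N : ℕ} (π : Equiv.Perm (Fin N)) : Set.InjOn (permIndex π) (Set.Iio N) := by
  intro i hi j hj h
  lift i to Fin N using hi
  lift j to Fin N using hj
  rw [permIndex_of_lt, permIndex_of_lt, Nat.add_right_cancel_iff, Fin.val_inj] at h
  rw [π.injective h]

theorem toList_prod_map {ι : Type*} (f : ι → Word) (u : List ι) :
    toList (u.map f).prod = u.flatMap fun i => toList (f i) := by
  induction u with
  | nil => rfl
  | cons i u ih => rw [List.map_cons, List.prod_cons, toList_mul, ih, List.flatMap_cons]

theorem flatMap_range_cons_append_last {α : Type*} (f : ℕ → α) (g : ℕ → List α) (k : ℕ) :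
    ((List.range k).flatMap fun i => f i :: g i) ++ [f k] =
      f 0 :: (List.range k).flatMap fun i => g i ++ [f (i + 1)] := by
  induction k with
  | zero => rfl
  | succ k ih =>
    rw [List.range_succ, List.flatMap_append, List.flatMap_append, List.flatMap_singleton,
      List.flatMap_singleton, ← List.cons_append, ← ih]
    simp only [List.append_assoc, List.cons_append, List.nil_append]

theorem perm_of_injOn_of_forall_mem {f : ℕ → ℕ} {n : ℕ} {v : List ℕ}
    (hf : Set.InjOn f (Set.Iio n)) (hmem : ∀ i < n, f i ∈ v) (hlen : v.length ≤ n) :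
    ((List.range n).map f).Perm v := by
  refine (List.subperm_of_subset ?_ fun a ha => ?_).perm_of_length_le (by simpa using hlen)
  · exact List.nodup_range.map_on fun i hi j hj h =>
      hf (List.mem_range.1 hi) (List.mem_range.1 hj) h
  · obtain ⟨i, hi, rfl⟩ := List.mem_map.1 ha
    exact hmem i (List.mem_range.1 hi)

variable {k : ℕ} {π : Equiv.Perm (Fin (k + 1 + (k + 1)))}

theorem map_permIndex_firstHalf_perm (hπ : π ∈ sharpPerm (k + 1)) :
    ((List.range (k + 1)).map (permIndex π)).Perm
      ((List.range (k + 1)).map fun i => k + 1 + i + 1) := by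
  refine perm_of_injOn_of_forall_mem
    ((permIndex_injOn π).mono (Set.Iio_subset_Iio (by omega))) (fun i hi => ?_) (by simp)
  lift i to Fin (k + 1 + (k + 1)) using by omega
  have := hπ.1 i hi
  rw [permIndex_of_lt]
  exact List.mem_map.2 ⟨π i - (k + 1), List.mem_range.2 (by omega), by omega⟩

theorem map_permIndex_secondHalf_perm (hπ : π ∈ sharpPerm (k + 1)) :
    ((List.range (k + 1)).map fun i => permIndex π (k + 1 + i)).Perm
      ((List.range (k + 1)).map (· + 1)) := by
  refine perm_of_injOn_of_forall_mem (fun i hi j hj h => ?_) (fun i hi => ?_) (by simp)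
  · rw [Set.mem_Iio] at hi hj
    exact Nat.add_left_cancel
      (permIndex_injOn π (Set.mem_Iio.2 (by omega)) (Set.mem_Iio.2 (by omega)) h)
  · obtain ⟨m, hm⟩ : ∃ m : Fin (k + 1 + (k + 1)), k + 1 + i = m := ⟨⟨k + 1 + i, by omega⟩, rfl⟩
    have := hπ.2 m (by omega)
    rw [hm, permIndex_of_lt]
    exact List.mem_map.2 ⟨π m, List.mem_range.2 this, rfl⟩

theorem flatMap_permBlock (π : Equiv.Perm (Fin (k + 1 + (k + 1)))) :
    (List.range (k + 1 + (k + 1))).flatMap (permBlock π) =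
      ((List.range k).flatMap fun i => [z (permIndex π i), y (i + 1), y (i + 1)]) ++
        [z (permIndex π k), y (k + 1), y (k + 1), z (permIndex π (k + 1))] ++
        (List.range k).flatMap fun i =>
          [y (k + 1 + i + 1), y (k + 1 + i + 1), z (permIndex π (k + 1 + i + 1))] := by
  have hlast : permBlock π (k + 1 + k) = [z (permIndex π (k + 1 + k))] := by
    rw [permBlock, if_neg (by omega)]
  have hblock {i : ℕ} (hi : i < k + 1 + k) :
      permBlock π i = [z (permIndex π i), y (i + 1), y (i + 1)] := by
    rw [permBlock, if_pos (by omega)]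
  have hfirst : (List.range k).flatMap (permBlock π) =
      (List.range k).flatMap fun i => [z (permIndex π i), y (i + 1), y (i + 1)] :=
    List.flatMap_congr fun i hi => hblock (by rw [List.mem_range] at hi; omega)
  have hsecond : ((List.range k).flatMap fun i => permBlock π (k + 1 + i)) =
      (List.range k).flatMap fun i =>
        [z (permIndex π (k + 1 + i)), y (k + 1 + i + 1), y (k + 1 + i + 1)] :=
    List.flatMap_congr fun i hi => hblock (by rw [List.mem_range] at hi; omega)
  have hregroup := flatMap_range_cons_append_last (fun i => z (permIndex π (k + 1 + i)))
    (fun i => [y (k + 1 + i + 1), y (k + 1 + i + 1)]) k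
  simp only [List.cons_append, List.nil_append] at hregroup
  rw [List.range_add, List.flatMap_append, List.flatMap_map, List.range_succ, List.flatMap_append,
    List.flatMap_append, List.flatMap_singleton, List.flatMap_singleton, hfirst, hsecond,
    hblock (by omega), hlast, hregroup]
  simp only [List.append_assoc, List.cons_append, List.nil_append]
  rfl

theorem toList_aWord (π : Equiv.Perm (Fin (k + 1 + (k + 1)))) :
    toList (aWord (k + 1) (k + 1) π) =
      ((List.range (k + 1)).map (· + 1)).flatMap (fun i => [z i, t i]) ++ [x] ++
      (List.range (k + 1 + (k + 1))).flatMap (permBlock π) ++ [x] ++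
      ((List.range (k + 1)).map fun i => k + 1 + i + 1).flatMap fun i => [t i, z i] := by
  have hblock (i : Fin (k + 1 + (k + 1))) : toList (wz ((π i : ℕ) + 1) *
      (if (i : ℕ) + 1 < k + 1 + (k + 1) then wy ((i : ℕ) + 1) ^ 2 else 1)) = permBlock π i := by
    rw [permBlock, permIndex_of_lt]
    split_ifs <;> rfl
  have hprod : (List.range (k + 1 + (k + 1))).flatMap (permBlock π) =
      (List.finRange (k + 1 + (k + 1))).flatMap
        fun i : Fin (k + 1 + (k + 1)) => permBlock π i := by
    rw [← List.map_coe_finRange_eq_range, List.flatMap_map]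
  rw [hprod]
  simp only [aWord, toList_mul, toList_prod_map, hblock, List.flatMap_map]
  rfl

theorem exists_splitWord_word_eq (hπ : π ∈ sharpPerm (k + 1)) :
    ∃ S : SplitWord, ofList S.word = aWord (k + 1) (k + 1) π := by
  have hfirst := map_permIndex_firstHalf_perm hπ
  have hsecond := map_permIndex_secondHalf_perm hπ
  obtain ⟨J₁, J₂, hJ⟩ := List.append_of_mem (hfirst.subset
    (List.mem_map_of_mem (List.mem_range.2 k.lt_succ_self)))
  obtain ⟨I₁, I₂, hI⟩ := List.append_of_mem (hsecond.subset
    (List.mem_map_of_mem (List.mem_range.2 k.succ_pos)))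
  refine ⟨⟨I₁, I₂, J₁, J₂, permIndex π (k + 1), permIndex π k, k + 1,
    (List.range k).map fun i => (permIndex π i, i + 1),
    (List.range k).map fun i => (permIndex π (k + 1 + i + 1), k + 1 + i + 1), ?_, ?_, ?_, ?_⟩, ?_⟩
  · rw [← hJ, ← hI, List.nodup_append]
    refine ⟨List.nodup_range.map fun i j h => Nat.add_right_cancel h,
      List.nodup_range.map fun i j h => Nat.add_left_cancel (Nat.add_right_cancel h), ?_⟩
    simp only [List.mem_map, List.mem_range]
    omega
  · rw [hJ] at hfirst
    refine List.Perm.cons_inv (a := permIndex π k)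
      (List.Perm.trans ?_ (hfirst.trans List.perm_middle))
    rw [List.range_succ, List.map_append, List.map_map]
    exact (List.perm_append_singleton _ _).symm
  · rw [hI] at hsecond
    refine List.Perm.cons_inv (a := permIndex π (k + 1))
      (List.Perm.trans ?_ (hsecond.trans List.perm_middle))
    rw [List.range_succ_eq_map, List.map_cons, List.map_map, List.map_map]
    rfl
  · simp only [List.mem_append, List.mem_map, List.mem_range]
    rintro _ (⟨i, _, rfl⟩ | ⟨i, _, rfl⟩) <;> omega
  · apply toList.injective
    rw [toList_aWord, flatMap_permBlock, toList_ofList]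
    simp only [SplitWord.word, SplitWord.pre, SplitWord.suf, SplitWord.core, SplitWord.front,
      SplitWord.back, SplitWord.I, SplitWord.J]
    rw [hI, hJ, List.flatMap_map, List.flatMap_map]

end PermutationWords

section AlphaOne

open Letter FreeMonoid

theorem perm_square_append_singleton_iff {α : Type*} {a b : α} {u : List α} :
    u.Perm [a, a, b] ↔ u = [a, a, b] ∨ u = [a, b, a] ∨ u = [b, a, a] := by
  rw [← List.mem_permutations']
  simp [List.permutations', List.permutations'Aux]

theorem eq_of_context_perm_xxy {θ : Letter → List Letter} {l r w : List Letter}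
    (hw : w.Perm [x, x, y 0]) (h : (l ++ w.flatMap θ ++ r).Perm [x, x, y 0]) (hX : θ x ≠ [])
    (hY : θ (y 0) ≠ []) : l = [] ∧ r = [] ∧ θ x = [x] ∧ θ (y 0) = [y 0] := by
  have hperm : (l ++ (θ x ++ (θ x ++ θ (y 0))) ++ r).Perm [x, x, y 0] := by
    simpa using (((hw.flatMap_right θ).symm.append_left l).append_right r).trans h
  obtain ⟨a, X, hX⟩ := List.exists_cons_of_ne_nil hX
  obtain ⟨b, Y, hY⟩ := List.exists_cons_of_ne_nil hY
  rw [hX, hY] at hperm ⊢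
  have hlength := hperm.length_eq
  simp only [List.length_append, List.length_cons, List.length_nil] at hlength
  obtain rfl : X = [] := List.length_eq_zero_iff.1 (by omega)
  obtain rfl : Y = [] := List.length_eq_zero_iff.1 (by omega)
  obtain rfl : l = [] := List.length_eq_zero_iff.1 (by omega)
  obtain rfl : r = [] := List.length_eq_zero_iff.1 (by omega)
  have hab := perm_square_append_singleton_iff.1 hperm
  grind

theorem stable_of_perm_xxy {C : List Letter → Prop} (hC : ∀ u, C u → u.Perm [x, x, y 0])
    {u v : List Letter} (hu : u.Perm [x, x, y 0]) (hv : v.Perm [x, x, y 0]) (huv : C u ↔ C v) :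
    Stable {U | C (toList U)} (ofList u) (ofList v) := by
  refine stable_of_forall_flatMap fun θ l r => ?_
  by_cases h : θ x = [] ∨ θ (y 0) = []
  · have hflat {w : List Letter} (hw : w.Perm [x, x, y 0]) :
        w.flatMap θ = θ x ++ θ x ++ θ (y 0) := by
      rcases perm_square_append_singleton_iff.1 hw with rfl | rfl | rfl <;>
        rcases h with h | h <;> simp [h]
    rw [hflat hu, hflat hv]
  obtain ⟨hX, hY⟩ := not_or.1 h
  have hflat {w : List Letter} (hw : w.Perm [x, x, y 0]) (hx : θ x = [x])
      (hy : θ (y 0) = [y 0]) : [] ++ w.flatMap θ ++ [] = w := by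
    rcases perm_square_append_singleton_iff.1 hw with rfl | rfl | rfl <;> simp [hx, hy]
  constructor <;> intro h
  · obtain ⟨rfl, rfl, hx, hy⟩ := eq_of_context_perm_xxy hu (hC _ h) hX hY
    rw [hflat hu hx hy] at h
    rwa [hflat hv hx hy, ← huv]
  · obtain ⟨rfl, rfl, hx, hy⟩ := eq_of_context_perm_xxy hv (hC _ h) hX hY
    rw [hflat hv hx hy] at h
    rwa [hflat hu hx hy, huv]

theorem alphaOneAperiodic_of_alphaOne {u v : Word} (h : alphaOne u v) : alphaOneAperiodic u v :=
  fun M hM => h M fun e he => hM e (Set.mem_insert_of_mem _ he)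

theorem perm_of_alphaOne {u v : Word} (h : alphaOne u v) : (toList u).Perm (toList v) := by
  refine (mem_iff_of_fic_ofIdentities (C := {w | (toList u).Perm (toList w)})
    (fun e he => ?_) h).1 (.refl _)
  rcases he with rfl | rfl | rfl <;> intro θ l r <;>
    simp only [List.perm_iff_count, Set.mem_ofPred_eq, wx, wy, wz, wt, pow_succ, pow_zero, one_mul,
      map_mul, lift_eval_of, toList_mul, List.count_append] <;>
    exact forall_congr' fun c => by omega

namespace SplitWord

variable {S : SplitWord} {u v l r : List Letter} {θ : Letter → List Letter} {d e : Letter}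

theorem alphaOne_of_fic (huv : (sapirVariety alphaOne
    {((ofList S.word : Word) : alphaOne.Quotient)}).fic (ofList u) (ofList v))
    (h : l ++ u.flatMap θ ++ r = S.word) :
    alphaOne (ofList (l ++ v.flatMap θ ++ r)) (ofList S.word) := by
  have hlift (w : List Letter) : ofList (l ++ w.flatMap θ ++ r) =
      ofList l * lift (ofList ∘ θ) (ofList w) * ofList r := by
    apply toList.injective
    simp only [toList_mul, toList_lift, toList_ofList, Function.comp_def]
  rw [hlift]
  exact sapirVariety_context huv (alphaOne.eq.1 (congrArg _ ((hlift u).symm.trans (by rw [h]))))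

theorem perm_of_fic (huv : (sapirVariety alphaOne
    {((ofList S.word : Word) : alphaOne.Quotient)}).fic (ofList u) (ofList v))
    (hu : ∀ c, u.count c ≤ 2) : u.Perm v := by
  refine List.perm_iff_count.2 fun c => ?_
  set θ : Letter → List Letter := fun d => if d = c then [y S.h] else []
  have hθ (w : List Letter) : w.flatMap θ = List.replicate (w.count c) (y S.h) := by
    rw [flatMap_eq_flatten_replicate fun d _ hd => if_neg hd]
    simp only [if_pos, List.flatten_replicate_singleton]
  set l := S.pre ++ [x] ++ S.front ++ [z S.κ]
  set r := List.replicate (2 - u.count c) (y S.h) ++ [z S.ζ] ++ S.back ++ [x] ++ S.suf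
  have hword : l ++ u.flatMap θ ++ r = S.word := by
    have hsquare : List.replicate (u.count c) (y S.h) ++ List.replicate (2 - u.count c) (y S.h) =
        [y S.h, y S.h] := by
      rw [List.replicate_append_replicate, Nat.add_sub_cancel' (hu c)]
      rfl
    simp only [hθ, l, r, word, core, List.append_assoc]
    rw [← List.append_assoc (List.replicate _ _) (List.replicate _ _), hsquare]
    simp only [List.cons_append, List.nil_append]
  have hcount := (perm_of_alphaOne (alphaOne_of_fic huv hword)).count_eq (y S.h)
  simp only [toList_ofList, ← hword, hθ, List.count_append, List.count_replicate_self] at hcount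
  omega

theorem not_fic_yxx (h : l ++ u.flatMap θ ++ r = S.word) (he : e ∈ θ (y 0))
    (hd : d ∉ l ++ θ (y 0)) (hde : FirstLT S.word d e) (hrigid : Rigid S.word d ∨ Rigid S.word e) :
    ¬ (sapirVariety alphaOne
      {((ofList S.word : Word) : alphaOne.Quotient)}).fic (ofList u) (ofList [y 0, x, x]) := by
  intro huv
  have hsame : SameRigid S.word (l ++ [y 0, x, x].flatMap θ ++ r) :=
    .of_alphaOneAperiodic (alphaOneAperiodic.symm
      (alphaOneAperiodic_of_alphaOne (alphaOne_of_fic huv h)))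
  refine ((hrigid.elim (hsame.firstLT_iff · e) (hsame.firstLT_iff' · d)).2 hde).not_firstLT ?_
  have hsplit : l ++ [y 0, x, x].flatMap θ ++ r = (l ++ θ (y 0)) ++ (θ x ++ θ x ++ r) := by simp
  rw [hsplit]
  exact firstLT_append_of_mem (List.mem_append_right _ he) hd

theorem not_fic_xxy (h : l ++ u.flatMap θ ++ r = S.word) (he : e ∈ θ (y 0))
    (hd : d ∉ θ (y 0) ++ r) (hed : LastLT S.word e d) (hrigid : Rigid S.word d ∨ Rigid S.word e) :
    ¬ (sapirVariety alphaOne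
      {((ofList S.word : Word) : alphaOne.Quotient)}).fic (ofList u) (ofList [x, x, y 0]) := by
  intro huv
  have hsame : SameRigid S.word (l ++ [x, x, y 0].flatMap θ ++ r) :=
    .of_alphaOneAperiodic (alphaOneAperiodic.symm
      (alphaOneAperiodic_of_alphaOne (alphaOne_of_fic huv h)))
  refine ((hrigid.elim (hsame.lastLT_iff' · e) (hsame.lastLT_iff · d)).2 hed).not_lastLT ?_
  have hsplit : l ++ [x, x, y 0].flatMap θ ++ r = (l ++ θ x ++ θ x) ++ (θ (y 0) ++ r) := by simp
  rw [hsplit]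
  exact lastLT_append_of_mem hd (List.mem_append_left _ he)

theorem not_fic_xyx_yxx : ¬ (sapirVariety alphaOne
    {((ofList S.word : Word) : alphaOne.Quotient)}).fic (ofList [x, y 0, x])
      (ofList [y 0, x, x]) :=
  not_fic_yxx (θ := fun c => if c = x then [x] else S.core) (l := S.pre) (r := S.suf)
    (by simp [word]) (z_mem_core.2 (.inr S.κ_mem_J)) (by simp [x_not_mem_pre, x_not_mem_core])
    (firstLT_x_z S.κ_mem_J) (.inl rigid_x)

theorem not_fic_xyx_xxy : ¬ (sapirVariety alphaOne
    {((ofList S.word : Word) : alphaOne.Quotient)}).fic (ofList [x, y 0, x])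
      (ofList [x, x, y 0]) :=
  not_fic_xxy (θ := fun c => if c = x then [x] else S.core) (l := S.pre) (r := S.suf)
    (e := y S.h) (by simp [word]) (by simp [core]) (by simp [x_not_mem_suf, x_not_mem_core])
    lastLT_y_x (.inl rigid_x)

theorem not_fic_xxy_yxx : ¬ (sapirVariety alphaOne
    {((ofList S.word : Word) : alphaOne.Quotient)}).fic (ofList [x, x, y 0])
      (ofList [y 0, x, x]) := by
  have hκ := S.κ_mem_J
  refine not_fic_yxx (l := S.pre ++ [x] ++ S.front ++ [z S.κ]) (r := [])
    (θ := fun c => if c = x then [y S.h] else [z S.ζ] ++ S.back ++ [x] ++ S.suf)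
    ?_ ?_ ?_ (firstLT_y_t hκ) (.inr (rigid_t (List.mem_append_right _ hκ)))
  · simp [word, core]
  · simp [t_mem_suf, hκ]
  · simp [y_not_mem_pre, y_not_mem_front, y_not_mem_back, y_not_mem_suf]

theorem not_fic_yxx_xxy : ¬ (sapirVariety alphaOne
    {((ofList S.word : Word) : alphaOne.Quotient)}).fic (ofList [y 0, x, x])
      (ofList [x, x, y 0]) := by
  have hζ : S.ζ ∈ S.I := by simp [I]
  have hty : LastLT S.word (t S.ζ) (y S.h) := by
    rw [← firstLT_reverse, ← rev_word]
    exact firstLT_y_t (S.mem_rev_J.2 hζ)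
  refine not_fic_xxy (l := []) (r := [z S.ζ] ++ S.back ++ [x] ++ S.suf)
    (θ := fun c => if c = x then [y S.h] else S.pre ++ [x] ++ S.front ++ [z S.κ])
    ?_ ?_ ?_ hty (.inr (rigid_t (List.mem_append_left _ hζ)))
  · simp [word, core]
  · simp [t_mem_pre, hζ]
  · simp [y_not_mem_pre, y_not_mem_front, y_not_mem_back, y_not_mem_suf]

theorem perm_xxy_of_fic (huv : (sapirVariety alphaOne
    {((ofList S.word : Word) : alphaOne.Quotient)}).fic (ofList u) (ofList v))
    (hu : u.Perm [x, x, y 0]) : v.Perm [x, x, y 0] := by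
  refine (perm_of_fic huv fun c => ?_).symm.trans hu
  rw [hu.count_eq]
  by_cases hc : c = x
  · simp [hc]
  · simp [List.count_cons_of_ne (Ne.symm hc), List.count_le_length.trans]

theorem saturated_xxy_xyx : (sapirVariety alphaOne
    {((ofList S.word : Word) : alphaOne.Quotient)}).Saturated
      {U | toList U = [x, x, y 0] ∨ toList U = [x, y 0, x]} := by
  intro u v huv hu
  obtain ⟨u, rfl⟩ := ofList.surjective u
  obtain ⟨v, rfl⟩ := ofList.surjective v
  have hv := perm_xxy_of_fic huv (perm_square_append_singleton_iff.2 (hu.imp_right .inl))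
  rcases perm_square_append_singleton_iff.1 hv with rfl | rfl | rfl
  · exact .inl rfl
  · exact .inr rfl
  · rcases hu with rfl | rfl
    · exact absurd huv not_fic_xxy_yxx
    · exact absurd huv not_fic_xyx_yxx

theorem saturated_xyx_yxx : (sapirVariety alphaOne
    {((ofList S.word : Word) : alphaOne.Quotient)}).Saturated
      {U | toList U = [x, y 0, x] ∨ toList U = [y 0, x, x]} := by
  intro u v huv hu
  obtain ⟨u, rfl⟩ := ofList.surjective u
  obtain ⟨v, rfl⟩ := ofList.surjective v
  have hv := perm_xxy_of_fic huv (perm_square_append_singleton_iff.2 (.inr hu))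
  rcases perm_square_append_singleton_iff.1 hv with rfl | rfl | rfl
  · rcases hu with rfl | rfl
    · exact absurd huv not_fic_xyx_xxy
    · exact absurd huv not_fic_yxx_xxy
  · exact .inl rfl
  · exact .inr rfl

theorem not_isDistributive_sapirVariety_alphaOne (S : SplitWord) :
    ¬ (sapirVariety alphaOne
      {((ofList S.word : Word) : alphaOne.Quotient)}).IsDistributive := by
  have hxxy : [x, x, y 0].Perm [x, x, y 0] := .refl _
  have hxyx : [x, y 0, x].Perm [x, x, y 0] := perm_square_append_singleton_iff.2 (.inr (.inl rfl))
  have hyxx : [y 0, x, x].Perm [x, x, y 0] := perm_square_append_singleton_iff.2 (.inr (.inr rfl))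
  refine MonoidVariety.not_isDistributive_of_saturated
    (C₁ := {U | toList U = [x, x, y 0] ∨ toList U = [x, y 0, x]})
    (C₂ := {U | toList U = [x, y 0, x] ∨ toList U = [y 0, x, x]})
    (e₀ := (ofList [x, x, y 0], ofList [y 0, x, x]))
    (e₁ := (ofList [x, x, y 0], ofList [x, y 0, x]))
    (e₂ := (ofList [x, y 0, x], ofList [y 0, x, x]))
    (u := ofList [x, y 0, x]) (v := ofList [y 0, x, x])
    saturated_xxy_xyx saturated_xyx_yxx
    (stable_of_perm_xxy (C := fun U => U = [x, x, y 0] ∨ U = [x, y 0, x]) ?_ hxxy hxyx (by simp))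
    (stable_of_perm_xxy (C := fun U => U = [x, y 0, x] ∨ U = [y 0, x, x]) ?_ hxyx hyxx (by simp))
    (stable_of_perm_xxy (C := fun U => (U = [x, x, y 0] ∨ U = [x, y 0, x]) ∧
      (U = [x, y 0, x] ∨ U = [y 0, x, x])) ?_ hxxy hyxx (by simp))
    ⟨.inr rfl, .inl rfl⟩ (by simp) (fun M h₀ h₁ φ => (h₁ φ).symm.trans (h₀ φ)) (fun M _ h₂ => h₂)
  · rintro _ (rfl | rfl) <;> assumption
  · rintro _ (rfl | rfl) <;> assumption
  · rintro _ ⟨rfl | rfl, _⟩ <;> assumption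

end SplitWord

end AlphaOne

theorem mainTheorem8 (k : ℕ) (hk : 1 ≤ k) (π : Equiv.Perm (Fin (k + k))) (hπ : π ∈ sharpPerm k) :
    ¬ (aVariety alphaOne k π).IsDistributive ∧
      ¬ (aVariety alphaOneAperiodic k π).IsDistributive := by
  obtain ⟨k, rfl⟩ := Nat.exists_eq_add_of_le' hk
  obtain ⟨S, hS⟩ := exists_splitWord_word_eq hπ
  rw [aVariety, aVariety, ← hS]
  exact ⟨S.not_isDistributive_sapirVariety_alphaOne,
    S.not_isDistributive_sapirVariety_alphaOneAperiodic⟩
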